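/- Let $R>1$ and let $A$ be a real number with $A>(\log R)^2$. Notation: $u(s)=(s^2-1)^2+(s-1)^2$; $$J(\psi)=\int_0^1(\psi^2-1)^2\,dt+\int_0^1(\psi-1)^2\,dt,\qquad G(\psi)=\int_0^1\Big(\frac{\psi'}{\psi}\Big)^2dt-A;$$ $Q^{1,2}=\{\phi\in W^{1,2}(0,1):\phi(0)=1,\ \phi(1)=R\}$ (elements are identified with their absolutely continuous representatives on $[0,1]$); $Q_+$ is the set of strictly increasing $\phi\in C^2(0,1)\cap C[0,1]$ with $\phi(0)=1$, $\phi(1)=R$. The constraint $G(\phi)\le 0$, and likewise $G(\phi)=0$, includes finiteness of the integral in $G$. (a) The system $$\int_1^R\frac{ds}{s\sqrt{\mu+u(s)}}=\frac1{\sqrt\lambda},\qquad \frac1{\sqrt\lambda}\int_1^R\frac{\sqrt{\mu+u(s)}}{s}\,ds=A$$ has exactly one solution $(\lambda,\mu)$ with $\lambda,\mu>0$. The function $$f(\mu)=\int_1^R\frac{\sqrt{\mu+u(s)}}{s}\,ds\ \int_1^R\frac{ds}{s\sqrt{\mu+u(s)}}$$ is strictly decreasing on $(0,\infty)$, with $f(\mu)\to+\infty$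 as $\mu\to0^+$ and $f(\mu)\to(\log R)^2$ as $\mu\to\infty$. (b) There is exactly one function $\psi\in C^2(0,1)\cap Q^{1,2}$ such that, for some $\lambda>0$, (i) $\psi$ is a critical point of $J+\lambda G$ over the space of variations $W^{1,2}_0(0,1)$, and (ii) $G(\psi)=0$. Moreover, (i) holds for this $\psi$ with the $\lambda$ from (a), and, with $(\lambda,\mu)$ from (a): (iii) $\psi$ is strictly increasing on $[0,1]$ and solves, on $[0,1]$, $$\psi'=\frac1{\sqrt\lambda}\,\psi\,\sqrt{\mu+(\psi^2-1)^2+(\psi-1)^2},\qquad \psi(0)=1;$$ (iv) $\psi$ is the unique minimizer of $J$ over $\{\phi\in Q_+:G(\phi)\le0\}$, and also the unique minimizer of $J$ over $\{\phi\in Q^{1,2}:G(\phi)\le0\}$. (c) Let $\Omega\subset\mathbb R^2$ be the open disk of radius $R+2$ centred at the origin, let $\rho:\mathbb R^2\to[0,1]$ be smooth with $\rho=1$ on the disk $B(0,R+1)$ and $\rho=0$ outside $\Omega$, and let $P>0$ be such that $A=\|\rho\,\mathrm{id}\|^{-2}_{W^{5,2}_0(\Omega;\mathbb R^2)}P^2$.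 For a family of maps $F(\cdot,t)=f^t$, $t\in[0,1]$, from the unit circle $M=\mathbb S^1$ to $\mathbb R^2$, let $$\Psi(F)=\int_0^1\!\int_M\|(f^t)^*g_t-g_0\|^2\,\omega_M\,dt+\int_0^1\!\int_M\|(f^t)^*\mathrm{II}_t-\mathrm{II}_0\|^2\,\omega_M\,dt,$$ where $g_t$ and $\mathrm{II}_t$ are the first and second fundamental forms of $f^t(M)$ with the orientation induced by $f^t$ (the positive orientation on $M$ itself), $g_0$ and $\mathrm{II}_0$ are those of $M$, and $\omega_M$ and the norms are those of $M$. Consider the morphs from $\mathbb S^1$ to the circle of radius $R$ (continuous isotopies starting at the inclusion, absolutely continuous in time and $C^3$ diffeomorphisms onto the image for each $t$) of the form $F(p,t)=\phi(t)p$ with $\phi\in Q_+$ that are generated by the field $v(x,t)=\frac{\phi'(t)}{\phi(t)}\rho(x)x$ via $dq/dt=v(q,t)$, where $\|v\|_{L^2(0,1;W^{5,2}_0(\Omega;\mathbb R^2))}\le P$. Among these, $H(p,t)=\psi(t)p$ is the unique minimizer of $\Psi$. -/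

import Mathlib

open Set Filter Topology MeasureTheory

noncomputable section

namespace CircleMorph

/-- The plane `ℝ²` with its Euclidean structure. -/
abbrev Plane : Type := EuclideanSpace ℝ (Fin 2)

/-! ### Radius functions and the two functionals -/

/-- `W^{1,2}(0,1)`. In one dimension every class has exactly one representative that is absolutely
continuous on `[0,1]`; the weak derivative is then the classical derivative, which exists almost
everywhere. A function on the line stands for its restriction to `[0,1]`. -/
def MemW12 (ψ : ℝ → ℝ) : Prop :=
  AbsolutelyContinuousOnInterval ψ 0 1 ∧ MemLp (deriv ψ) 2 (volume.restrict (Ioo (0 : ℝ) 1))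

/-- `W_0^{1,2}(0,1)`. -/
def MemW012 (h : ℝ → ℝ) : Prop := MemW12 h ∧ h 0 = 0 ∧ h 1 = 0

/-- `Q^{1,2}`: the functions of `W^{1,2}(0,1)` with boundary values `1` and `R`. -/
def Q12 (R : ℝ) : Set (ℝ → ℝ) := {φ | MemW12 φ ∧ φ 0 = 1 ∧ φ 1 = R}

/-- `Q_+`: the strictly increasing functions in `C²(0,1) ∩ C[0,1]` with boundary values
`1` and `R`. -/
def Qplus (R : ℝ) : Set (ℝ → ℝ) :=
  {φ | ContDiffOn ℝ 2 φ (Ioo 0 1) ∧ ContinuousOn φ (Icc 0 1) ∧ φ 0 = 1 ∧ φ 1 = R ∧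
    StrictMonoOn φ (Icc 0 1)}

/-- `J(ψ) = ∫₀¹ (ψ² - 1)² dt + ∫₀¹ (ψ - 1)² dt`. -/
def J (ψ : ℝ → ℝ) : ℝ :=
  (∫ t in (0 : ℝ)..1, (ψ t ^ 2 - 1) ^ 2) + ∫ t in (0 : ℝ)..1, (ψ t - 1) ^ 2

/-- `G(ψ) = ∫₀¹ (ψ'/ψ)² dt - A`; meaningful when `FiniteG ψ` holds. -/
def G (A : ℝ) (ψ : ℝ → ℝ) : ℝ := (∫ t in (0 : ℝ)..1, (deriv ψ t / ψ t) ^ 2) - A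

/-- The integral in `G` is finite. -/
def FiniteG (ψ : ℝ → ℝ) : Prop :=
  IntegrableOn (fun t => (deriv ψ t / ψ t) ^ 2) (Ioo (0 : ℝ) 1) volume

/-- The functions that satisfy the constraint `G ≤ 0`. -/
def Constraint (A : ℝ) : Set (ℝ → ℝ) := {φ | FiniteG φ ∧ G A φ ≤ 0}

/-- `ψ` is a critical point of `J + lam G` over the space of variations `W_0^{1,2}(0,1)`. -/
def IsCriticalPoint (A lam : ℝ) (ψ : ℝ → ℝ) : Prop :=
  ∀ h : ℝ → ℝ, MemW012 h →
    HasDerivAt (fun ε : ℝ => J (fun t => ψ t + ε * h t) + lam * G A (fun t => ψ t + ε * h t)) 0 0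

/-- `x` minimizes `f` over `S`, and every minimizer is identified with `x` by the relation `r`. -/
def IsUniqueMinimizer {α : Type} (f : α → ℝ) (S : Set α) (r : α → α → Prop) (x : α) : Prop :=
  x ∈ S ∧ (∀ y ∈ S, f x ≤ f y) ∧ ∀ y ∈ S, (∀ z ∈ S, f y ≤ f z) → r y x

/-- Equality of functions on `[0,1]`. -/
def SameOnUnit (φ ψ : ℝ → ℝ) : Prop := EqOn φ ψ (Icc 0 1)

/-! ### The system for the two constants -/

/-- `u(s) = (s² - 1)² + (s - 1)²`. -/
def u (s : ℝ) : ℝ := (s ^ 2 - 1) ^ 2 + (s - 1) ^ 2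

/-- `∫₁^R ds / (s √(mu + u(s)))`. -/
def timeIntegral (R mu : ℝ) : ℝ := ∫ s in (1 : ℝ)..R, 1 / (s * √(mu + u s))

/-- `∫₁^R √(mu + u(s)) / s ds`. -/
def actionIntegral (R mu : ℝ) : ℝ := ∫ s in (1 : ℝ)..R, √(mu + u s) / s

/-- `(lam, mu)` is a positive solution of the system of two integral equations. -/
def SolvesSystem (R A lam mu : ℝ) : Prop :=
  0 < lam ∧ 0 < mu ∧ timeIntegral R mu = 1 / √lam ∧ 1 / √lam * actionIntegral R mu = A

/-! ### Morphs from the unit circle to the circle of radius `R` -/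

/-- The unit circle. -/
def unitCircle : Set Plane := Metric.sphere 0 1

/-- The positively oriented arc length parametrization of the unit circle. -/
def γ (s : ℝ) : Plane := !₂[Real.cos s, Real.sin s]

/-- Rotation by a quarter turn, counterclockwise. -/
def quarterTurn (w : Plane) : Plane := !₂[-(w 1), w 0]

/-- `F(·,t)`, `t ∈ [0,1]`, is a morph from the unit circle to the circle of radius `R` that is
absolutely continuous in time and of class `C³` in space: a continuous isotopy that starts at the
inclusion, ends on the circle of radius `R`, and consists of `C³` diffeomorphisms onto the image
(injective immersions of the compact circle). -/
structure IsMorph (R : ℝ) (F : Plane → ℝ → Plane) : Prop where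
  continuousOn : ContinuousOn (fun q : Plane × ℝ => F q.1 q.2) (unitCircle ×ˢ Icc 0 1)
  initial : ∀ p ∈ unitCircle, F p 0 = p
  final : (fun p => F p 1) '' unitCircle = Metric.sphere 0 R
  absCont : ∀ p ∈ unitCircle, AbsolutelyContinuousOnInterval (F p) 0 1
  smooth : ∀ t ∈ Icc (0 : ℝ) 1, ContDiff ℝ 3 (fun s => F (γ s) t)
  immersion : ∀ t ∈ Icc (0 : ℝ) 1, ∀ s, deriv (fun s => F (γ s) t) s ≠ 0
  injective : ∀ t ∈ Icc (0 : ℝ) 1, InjOn (fun p => F p t) unitCircle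

/-- The first fundamental form of the curve `c`, evaluated at the pair `(∂_s, ∂_s)`. -/
def firstForm (c : ℝ → Plane) (s : ℝ) : ℝ := inner ℝ (deriv c s) (deriv c s)

/-- The second fundamental form of the oriented curve `c`, evaluated at the pair `(∂_s, ∂_s)`;
the unit normal is the unit tangent turned counterclockwise, so that the positively oriented
circle of radius `r` has curvature `1 / r`. -/
def secondForm (c : ℝ → Plane) (s : ℝ) : ℝ :=
  inner ℝ (deriv (deriv c) s) (quarterTurn (deriv c s)) / ‖deriv c s‖

/-- The distortion energy of a morph: the squared fibre norms of `F(·,t)^* g_t - g_0` and of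
`F(·,t)^* II_t - II_0` integrated over the unit circle and over `[0,1]`. Since `γ` has unit speed,
the fibre norm of a `(0,2)` tensor is the absolute value of its value at `(∂_s, ∂_s)`. -/
def distortionEnergy (F : Plane → ℝ → Plane) : ℝ :=
  (∫ t in (0 : ℝ)..1, ∫ s in (0 : ℝ)..(2 * Real.pi),
      (firstForm (fun s => F (γ s) t) s - firstForm γ s) ^ 2) +
    ∫ t in (0 : ℝ)..1, ∫ s in (0 : ℝ)..(2 * Real.pi),
      (secondForm (fun s => F (γ s) t) s - secondForm γ s) ^ 2

/-! ### The vector fields generating radial morphs -/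

/-- The open disk `Ω` of radius `R + 2`. -/
def Ω (R : ℝ) : Set Plane := Metric.ball 0 (R + 2)

/-- A smooth bump function, equal to `1` on the disk of radius `R + 1` and to `0` outside `Ω`. -/
def IsBump (R : ℝ) (ρ : Plane → ℝ) : Prop :=
  ContDiff ℝ (⊤ : ℕ∞) ρ ∧ (∀ x, 0 ≤ ρ x ∧ ρ x ≤ 1) ∧ (∀ x ∈ Metric.ball (0 : Plane) (R + 1), ρ x = 1) ∧
    ∀ x ∉ Ω R, ρ x = 0

/-- The partial derivative `∂^m w / ∂x₁^a ∂x₂^(m-a)`. -/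
def partialDeriv (m a : ℕ) (w : Plane → Plane) (x : Plane) : Plane :=
  iteratedFDeriv ℝ m w x
    (fun i : Fin m => if (i : ℕ) < a then EuclideanSpace.single 0 1 else EuclideanSpace.single 1 1)

/-- The square of the norm of `W^{k,2}(Ω; ℝ²)`, for a smooth field `w`: the sum of
`∫_Ω |D^α w|²` over the multi-indices `α = (a, m - a)` with `|α| = m ≤ k`. -/
def sobolevNormSq (R : ℝ) (k : ℕ) (w : Plane → Plane) : ENNReal :=
  ∑ m ∈ Finset.range (k + 1), ∑ a ∈ Finset.range (m + 1),
    ∫⁻ x in Ω R, ‖partialDeriv m a w x‖ₑ ^ 2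

/-- The square of the norm of `L²(0,1; W_0^{k,2}(Ω; ℝ²))`, for a time-dependent vector field that is
smooth in space and vanishes outside `Ω`. -/
def fieldNormSq (R : ℝ) (k : ℕ) (v : Plane → ℝ → Plane) : ENNReal :=
  ∫⁻ t in Ioo (0 : ℝ) 1, sobolevNormSq R k (fun x => v x t)

/-- `v(x,t) = (φ'(t) / φ(t)) ρ(x) x`. -/
def radialField (ρ : Plane → ℝ) (φ : ℝ → ℝ) (x : Plane) (t : ℝ) : Plane :=
  (deriv φ t / φ t) • (ρ x • x)

/-- The field `v` generates `F` via the evolution equation `dq/dt = v(q,t)`. -/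
def Generates (v F : Plane → ℝ → Plane) : Prop :=
  ∀ p ∈ unitCircle, ∀ t ∈ Ioo (0 : ℝ) 1, HasDerivAt (F p) (v (F p t) t) t

/-- The radial morph `H(p,t) = φ(t) p`. -/
def radialMorph (φ : ℝ → ℝ) (p : Plane) (t : ℝ) : Plane := φ t • p

/-- Equality on `unit circle × [0,1]`. -/
def SameMorph (F H : Plane → ℝ → Plane) : Prop :=
  ∀ p ∈ unitCircle, ∀ t ∈ Icc (0 : ℝ) 1, F p t = H p t

/-- The morphs of the form `φ(t) p`, `φ ∈ Q_+`, whose generating field `(φ'/φ) ρ(x) x` has norm at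
most `P` in `L²(0,1; W_0^{5,2}(Ω; ℝ²))`. -/
def admissibleMorphs (R : ℝ) (ρ : Plane → ℝ) (P : ℝ) : Set (Plane → ℝ → Plane) :=
  {F | IsMorph R F ∧ ∃ φ ∈ Qplus R, SameMorph F (radialMorph φ) ∧ Generates (radialField ρ φ) F ∧
    fieldNormSq R 5 (radialField ρ φ) ≤ ENNReal.ofReal (P ^ 2)}

/-- `A(P) = ‖ρ id‖⁻² P²`, with the norm of `W_0^{5,2}(Ω; ℝ²)`. -/
def constantA (R : ℝ) (ρ : Plane → ℝ) (P : ℝ) : ℝ :=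
  (sobolevNormSq R 5 (fun x => ρ x • x)).toReal⁻¹ * P ^ 2

end CircleMorph

end

/-!
Write `θ = log φ`. The constraint becomes `∫ θ'² ≤ A`, which is convex, and `J(φ) = ∫ u(e^θ)`. The
function `θ ↦ u(e^θ)` is not convex on the whole line, but its graph lies above the tangent line at
every point `θ ≥ 0` (`u_tangent_log`). Hence every solution `ψ ≥ 1` of the Euler–Lagrange equation
with a positive multiplier `lam` and `G(ψ) = 0` is a minimizer, with the gap
`J(φ) - J(ψ) ≥ lam ∫ (φ'/φ - ψ'/ψ)²` (`J_add_le`), and this gap gives uniqueness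
(`sameOnUnit_of_J_le`). Only the weak form of the equation, tested with `log φ - log ψ`, is used.

Three facts make this apply to all competitors and all critical points. Finiteness of `∫ (φ'/φ)²`
keeps a function of `W^{1,2}` positive (`pos_of_finiteG`), so that `log φ` is absolutely continuous
and the variations `h = φ k` exhaust `W_0^{1,2}` (`isCriticalPoint_iff`). A critical point stays
above `1` (`one_le_of_weakEulerLagrange`), so any two critical points with `G = 0` minimize, and
therefore agree. A function of `Q_+` that satisfies the constraint belongs to `Q^{1,2}`
(`Qplus_subset_Q12`).

Existence comes from the first integral `(ψ'/ψ)² = (mu + u(ψ)) / lam` of the Euler–Lagrange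
equation. Its solution is the inverse of `x ↦ √lam ∫_1^x ds / (s √(mu + u(s)))`
(`exists_isProfile`); reaching `R` at time `1` and having `∫ (ψ'/ψ)² = A` are the two equations of
the system. They are uniquely solvable because the product of the two integrals decreases strictly
from `∞` to `(log R)²`. For the monotonicity, the derivative in `R` of the difference of the products
at two parameters is the integral of a difference of expressions `r + 1 / r`, in which the larger
parameter has its `r > 1` closer to `1` (`product_strictAntiOn`).

On radial morphs the distortion energy is `2 π J` (`distortionEnergy_eq`), and the bound on the norm
of the generating field is the constraint `G ≤ 0` (`fieldNormSq_le_iff`), since this norm is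
the norm of `φ'/φ` in `L²(0,1)` times that of `ρ id`.
-/

noncomputable section

namespace CircleMorph

/-! ### Absolutely continuous functions -/

theorem _root_.AbsolutelyContinuousOnInterval.lipschitzOn_comp {f g : ℝ → ℝ} {a b : ℝ}
    {s : Set ℝ} {K : NNReal} (hf : AbsolutelyContinuousOnInterval f a b)
    (hg : LipschitzOnWith K g s) (hs : MapsTo f (uIcc a b) s) :
    AbsolutelyContinuousOnInterval (fun t => g (f t)) a b := by
  unfold AbsolutelyContinuousOnInterval at hf ⊢
  have h0 := hf.const_mul (K : ℝ)
  rw [mul_zero] at h0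
  refine squeeze_zero' (Eventually.of_forall fun E => Finset.sum_nonneg fun i _ => dist_nonneg)
    ?_ h0
  filter_upwards [mem_inf_of_right (mem_principal_self _)] with E hE
  rw [Finset.mul_sum]
  refine Finset.sum_le_sum fun i hi => ?_
  exact hg.dist_le_mul _ (hs (hE.1 i hi).1) _ (hs (hE.1 i hi).2)

/-- The range of `f` is a compact interval, and there the `C¹` function `g` is Lipschitz. -/
theorem _root_.AbsolutelyContinuousOnInterval.contDiffOn_comp {f g : ℝ → ℝ} {a b : ℝ}
    {s : Set ℝ} (hf : AbsolutelyContinuousOnInterval f a b)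
    (hg : ContDiffOn ℝ 1 g s) (hs : MapsTo f (uIcc a b) s) :
    AbsolutelyContinuousOnInterval (fun t => g (f t)) a b := by
  have himg : f '' uIcc a b = Icc (sInf (f '' uIcc a b)) (sSup (f '' uIcc a b)) :=
    eq_Icc_of_connected_compact
      (IsConnected.image ⟨nonempty_uIcc, isPreconnected_uIcc⟩ _ hf.continuousOn)
      (isCompact_uIcc.image_of_continuousOn hf.continuousOn)
  have hsub : Icc (sInf (f '' uIcc a b)) (sSup (f '' uIcc a b)) ⊆ s := by
    rw [← himg]; exact hs.image_subset
  obtain ⟨K, hK⟩ := (hg.mono hsub).exists_lipschitzOnWith (by decide) (convex_Icc _ _)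
    isCompact_Icc
  exact hf.lipschitzOn_comp hK (by rw [← himg]; exact mapsTo_image f _)

theorem _root_.AbsolutelyContinuousOnInterval.log {f : ℝ → ℝ} {a b : ℝ}
    (hf : AbsolutelyContinuousOnInterval f a b) (hpos : ∀ t ∈ uIcc a b, 0 < f t) :
    AbsolutelyContinuousOnInterval (fun t => Real.log (f t)) a b :=
  hf.contDiffOn_comp (s := Ioi 0)
    (fun _ hx => (Real.contDiffAt_log.2 (ne_of_gt hx)).contDiffWithinAt) hpos

theorem _root_.AbsolutelyContinuousOnInterval.inv {f : ℝ → ℝ} {a b : ℝ}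
    (hf : AbsolutelyContinuousOnInterval f a b) (hpos : ∀ t ∈ uIcc a b, 0 < f t) :
    AbsolutelyContinuousOnInterval (fun t => (f t)⁻¹) a b :=
  hf.contDiffOn_comp (s := Ioi 0)
    (fun _ hx => (contDiffAt_inv ℝ (ne_of_gt hx)).contDiffWithinAt) hpos

theorem intervalIntegrable_unit {f : ℝ → ℝ} :
    IntervalIntegrable f volume 0 1 ↔ IntegrableOn f (Ioo (0 : ℝ) 1) :=
  intervalIntegrable_iff_integrableOn_Ioo_of_le zero_le_one

theorem integral_unit (f : ℝ → ℝ) : ∫ t in (0 : ℝ)..1, f t = ∫ t in Ioo (0 : ℝ) 1, f t := by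
  rw [intervalIntegral.integral_of_le zero_le_one, integral_Ioc_eq_integral_Ioo]

theorem ae_unit_differentiableAt {f : ℝ → ℝ} (hf : AbsolutelyContinuousOnInterval f 0 1) :
    ∀ᵐ t ∂volume.restrict (Ioo (0 : ℝ) 1), DifferentiableAt ℝ f t := by
  rw [ae_restrict_iff' measurableSet_Ioo]
  filter_upwards [hf.ae_differentiableAt] with t ht h
  exact ht (by rw [uIcc_of_le zero_le_one]; exact Ioo_subset_Icc_self h)

theorem continuousOn_unit {f : ℝ → ℝ} (hf : AbsolutelyContinuousOnInterval f 0 1) :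
    ContinuousOn f (Icc 0 1) := by
  have := hf.continuousOn
  rwa [uIcc_of_le zero_le_one] at this

theorem intervalIntegrable_of_continuousOn_unit {f : ℝ → ℝ} (hf : ContinuousOn f (Icc 0 1)) :
    IntervalIntegrable f volume 0 1 :=
  hf.intervalIntegrable_of_Icc zero_le_one

theorem aestronglyMeasurable_unit {f : ℝ → ℝ} (hf : ContinuousOn f (Icc 0 1)) :
    AEStronglyMeasurable f (volume.restrict (Ioo (0 : ℝ) 1)) :=
  (hf.mono Ioo_subset_Icc_self).aestronglyMeasurable measurableSet_Ioo

theorem memLp_two_logDeriv {φ : ℝ → ℝ} (hc : ContinuousOn φ (Icc 0 1)) (hG : FiniteG φ) :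
    MemLp (fun t => deriv φ t / φ t) 2 (volume.restrict (Ioo (0 : ℝ) 1)) := by
  rw [memLp_two_iff_integrable_sq]
  · exact hG
  · exact ((measurable_deriv φ).aemeasurable.div
      (aestronglyMeasurable_unit hc).aemeasurable).aestronglyMeasurable

theorem logDeriv_intervalIntegrable {φ : ℝ → ℝ} (hc : ContinuousOn φ (Icc 0 1))
    (hG : FiniteG φ) : IntervalIntegrable (fun t => deriv φ t / φ t) volume 0 1 :=
  intervalIntegrable_unit.2 ((memLp_two_logDeriv hc hG).integrable one_le_two)

theorem memLp_two_continuousOn_mul {f g : ℝ → ℝ} (hf : ContinuousOn f (Icc 0 1))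
    (hg : MemLp g 2 (volume.restrict (Ioo (0 : ℝ) 1))) :
    MemLp (fun t => f t * g t) 2 (volume.restrict (Ioo (0 : ℝ) 1)) := by
  obtain ⟨C, hC⟩ := isCompact_Icc.exists_bound_of_continuousOn hf
  refine MemLp.of_le_mul (c := C) hg ((aestronglyMeasurable_unit hf).mul hg.1) ?_
  rw [ae_restrict_iff' measurableSet_Ioo]
  refine Eventually.of_forall fun t ht => ?_
  rw [norm_mul]
  exact mul_le_mul_of_nonneg_right (hC t (Ioo_subset_Icc_self ht)) (norm_nonneg _)

/-- Finiteness of `∫ (φ'/φ)²` keeps `φ` away from zero: up to the first zero, `|log φ|` is bounded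
by the integral of `|φ'/φ|`. -/
theorem pos_of_finiteG {φ : ℝ → ℝ} (hφ : AbsolutelyContinuousOnInterval φ 0 1) (h0 : φ 0 = 1)
    (hG : FiniteG φ) : ∀ t ∈ Icc (0 : ℝ) 1, 0 < φ t := by
  have hc := continuousOn_unit hφ
  have hint := logDeriv_intervalIntegrable hc hG
  by_contra! hcon
  obtain ⟨t₁, ht₁, hneg⟩ := hcon
  have hne : (Icc (0 : ℝ) 1 ∩ φ ⁻¹' Iic 0).Nonempty := ⟨t₁, ht₁, hneg⟩
  have hcpt : IsCompact (Icc (0 : ℝ) 1 ∩ φ ⁻¹' Iic 0) :=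
    isCompact_Icc.of_isClosed_subset (hc.preimage_isClosed_of_isClosed isClosed_Icc isClosed_Iic)
      inter_subset_left
  obtain ⟨t₀, ⟨ht₀, hφ₀⟩, hleast⟩ := hcpt.exists_isLeast hne
  have hφ₀' : φ t₀ ≤ 0 := hφ₀
  have ht₀pos : 0 < t₀ := by
    rcases eq_or_lt_of_le ht₀.1 with h | h
    · rw [← h, h0] at hφ₀'; linarith
    · exact h
  set M := ∫ t in (0 : ℝ)..1, |deriv φ t / φ t| with hM
  have hlow : ∀ t ∈ Ico 0 t₀, Real.exp (-M) ≤ φ t := by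
    intro t ht
    have hsub : Icc 0 t ⊆ Icc (0 : ℝ) 1 := Icc_subset_Icc_right (ht.2.le.trans ht₀.2)
    have hpos : ∀ s ∈ Icc 0 t, 0 < φ s := by
      intro s hs
      by_contra! hs'
      have := hleast ⟨hsub hs, hs'⟩
      linarith [hs.2, ht.2]
    have hac : AbsolutelyContinuousOnInterval φ 0 t := hφ.mono (by
      rw [uIcc_of_le ht.1, uIcc_of_le zero_le_one]; exact hsub)
    have hlog := hac.log (by rwa [uIcc_of_le ht.1])
    have h1 := hlog.integral_deriv_eq_sub
    have h2 : ∫ s in (0 : ℝ)..t, deriv (fun t => Real.log (φ t)) s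
        = ∫ s in (0 : ℝ)..t, deriv φ s / φ s := by
      refine intervalIntegral.integral_congr_ae ?_
      filter_upwards [hac.ae_differentiableAt] with s hs hs'
      have hmem : s ∈ uIcc 0 t := uIoc_subset_uIcc hs'
      rw [deriv.log (hs hmem) (hpos s (by rwa [uIcc_of_le ht.1] at hmem)).ne']
    rw [h2, h0, Real.log_one, sub_zero] at h1
    have h3 : |∫ s in (0 : ℝ)..t, deriv φ s / φ s| ≤ M := by
      refine (intervalIntegral.abs_integral_le_integral_abs ht.1).trans ?_
      exact intervalIntegral.integral_mono_interval le_rfl ht.1 (ht.2.le.trans ht₀.2)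
        (Eventually.of_forall fun _ => abs_nonneg _) hint.abs
    rw [h1] at h3
    have h4 := (abs_le.1 h3).1
    calc Real.exp (-M) ≤ Real.exp (Real.log (φ t)) := Real.exp_le_exp.2 h4
      _ = φ t := Real.exp_log (hpos t ⟨ht.1, le_rfl⟩)
  have hcl : t₀ ∈ closure (Ico 0 t₀) := by
    rw [closure_Ico ht₀pos.ne]; exact ⟨ht₀pos.le, le_rfl⟩
  have hcw : ContinuousWithinAt φ (Ico 0 t₀) t₀ := (hc t₀ ht₀).mono
    (Ico_subset_Icc_self.trans (Icc_subset_Icc_right ht₀.2))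
  have : φ t₀ ∈ closure (Ici (Real.exp (-M))) := hcw.mem_closure hcl hlow
  rw [closure_Ici] at this
  have h5 : Real.exp (-M) ≤ φ t₀ := this
  linarith [Real.exp_pos (-M)]

theorem ae_deriv_log {φ : ℝ → ℝ} (hφ : AbsolutelyContinuousOnInterval φ 0 1)
    (hpos : ∀ t ∈ Icc (0 : ℝ) 1, 0 < φ t) :
    ∀ᵐ t ∂volume.restrict (Ioo (0 : ℝ) 1),
      deriv (fun t => Real.log (φ t)) t = deriv φ t / φ t := by
  filter_upwards [ae_unit_differentiableAt hφ, ae_restrict_mem measurableSet_Ioo] with t ht h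
  rw [deriv.log ht (hpos t (Ioo_subset_Icc_self h)).ne']

theorem logAC {φ : ℝ → ℝ} (hφ : AbsolutelyContinuousOnInterval φ 0 1)
    (hpos : ∀ t ∈ Icc (0 : ℝ) 1, 0 < φ t) :
    AbsolutelyContinuousOnInterval (fun t => Real.log (φ t)) 0 1 :=
  hφ.log (by rwa [uIcc_of_le zero_le_one])

theorem memW12_of_finiteG {φ : ℝ → ℝ} (hac : AbsolutelyContinuousOnInterval φ 0 1)
    (hpos : ∀ t ∈ Icc (0 : ℝ) 1, 0 < φ t) (hG : FiniteG φ) : MemW12 φ := by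
  have hc := continuousOn_unit hac
  refine ⟨hac, MemLp.ae_eq ?_ (memLp_two_continuousOn_mul hc (memLp_two_logDeriv hc hG))⟩
  filter_upwards [ae_restrict_mem measurableSet_Ioo] with t ht
  exact mul_div_cancel₀ _ (hpos t (Ioo_subset_Icc_self ht)).ne'

theorem finiteG_of_memW12 {φ : ℝ → ℝ} (h : MemW12 φ)
    (hpos : ∀ t ∈ Icc (0 : ℝ) 1, 0 < φ t) : FiniteG φ := by
  have hc : ContinuousOn (fun t => (φ t)⁻¹) (Icc 0 1) :=
    (continuousOn_unit h.1).inv₀ fun t ht => (hpos t ht).ne'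
  have := (memLp_two_continuousOn_mul hc h.2).integrable_sq
  refine this.congr (Eventually.of_forall fun t => ?_)
  simp only [div_eq_inv_mul]

/-- A function of `Q_+` with finite `∫ (φ'/φ)²` is the primitive of its integrable derivative. -/
theorem Qplus_subset_Q12 {R : ℝ} {φ : ℝ → ℝ} (hφ : φ ∈ Qplus R) (hG : FiniteG φ) :
    φ ∈ Q12 R := by
  obtain ⟨hd, hc, h0, h1, hmono⟩ := hφ
  have hpos : ∀ t ∈ Icc (0 : ℝ) 1, 0 < φ t := fun t ht => by
    have := hmono.monotoneOn (left_mem_Icc.2 zero_le_one) ht ht.1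
    rw [h0] at this; linarith
  have hint : IntervalIntegrable (deriv φ) volume 0 1 := by
    have h2 := (memLp_two_continuousOn_mul hc (memLp_two_logDeriv hc hG)).integrable one_le_two
    refine intervalIntegrable_unit.2 (h2.congr ?_)
    filter_upwards [ae_restrict_mem measurableSet_Ioo] with t ht
    exact mul_div_cancel₀ _ (hpos t (Ioo_subset_Icc_self ht)).ne'
  have hac : AbsolutelyContinuousOnInterval φ 0 1 := by
    have hprim := hint.absolutelyContinuousOnInterval_intervalIntegral
      (c := 0) (left_mem_uIcc)
    have hconst : AbsolutelyContinuousOnInterval (fun _ : ℝ => (1 : ℝ)) 0 1 :=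
      contDiffOn_const.absolutelyContinuousOnInterval
    have hsum := hconst.add hprim
    rw [absolutelyContinuousOnInterval_iff] at hsum ⊢
    intro ε hε
    obtain ⟨δ, hδ, h⟩ := hsum ε hε
    refine ⟨δ, hδ, fun E hE hlt => ?_⟩
    refine lt_of_eq_of_lt ?_ (h E hE hlt)
    have heq : ∀ x ∈ uIcc (0 : ℝ) 1,
        φ x = ((fun _ : ℝ => (1 : ℝ)) + fun x => ∫ v in (0 : ℝ)..x, deriv φ v) x := by
      intro x hx
      rw [uIcc_of_le zero_le_one] at hx
      have hsub : Icc 0 x ⊆ Icc (0 : ℝ) 1 := Icc_subset_Icc_right hx.2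
      have := intervalIntegral.integral_eq_sub_of_hasDerivAt_of_le hx.1 (hc.mono hsub)
        (f' := deriv φ) (fun y hy => ?_) (hint.mono_set (by
          rw [uIcc_of_le hx.1, uIcc_of_le zero_le_one]; exact hsub))
      · simp only [Pi.add_apply, this, h0]; ring
      · have hy' : y ∈ Ioo (0 : ℝ) 1 := ⟨hy.1, hy.2.trans_le hx.2⟩
        exact ((hd.differentiableOn (by norm_num)).differentiableAt
          (isOpen_Ioo.mem_nhds hy')).hasDerivAt
    refine Finset.sum_congr rfl fun i hi => ?_
    rw [heq _ (hE.1 i hi).1, heq _ (hE.1 i hi).2]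
  exact ⟨memW12_of_finiteG hac hpos hG, h0, h1⟩

/-! ### The system of integral equations -/

theorem u_nonneg (s : ℝ) : 0 ≤ u s := by unfold u; positivity

theorem continuous_u : Continuous u := by unfold u; fun_prop

theorem contDiff_u {n : WithTop ℕ∞} : ContDiff ℝ n u := by unfold u; fun_prop

theorem add_u_pos {mu : ℝ} (hmu : 0 < mu) (s : ℝ) : 0 < mu + u s :=
  add_pos_of_pos_of_nonneg hmu (u_nonneg s)

theorem sqrt_add_u_pos {mu : ℝ} (hmu : 0 < mu) (s : ℝ) : 0 < √(mu + u s) :=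
  Real.sqrt_pos.2 (add_u_pos hmu s)

theorem continuous_sqrt_add_u (mu : ℝ) : Continuous fun s => √(mu + u s) :=
  (continuous_const.add continuous_u).sqrt

theorem u_strictMonoOn : StrictMonoOn u (Ici 1) := by
  intro a ha b hb hab
  rw [mem_Ici] at ha hb
  unfold u
  have h1 : (a - 1) ^ 2 < (b - 1) ^ 2 := by nlinarith
  have h2 : (a ^ 2 - 1) ^ 2 < (b ^ 2 - 1) ^ 2 := by
    apply pow_lt_pow_left₀ _ _ two_ne_zero <;> nlinarith
  linarith

theorem continuousOn_timeIntegrand {mu : ℝ} (hmu : 0 < mu) :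
    ContinuousOn (fun s => 1 / (s * √(mu + u s))) (Ioi 0) :=
  continuousOn_const.div (continuousOn_id.mul (continuous_sqrt_add_u mu).continuousOn)
    fun s hs => (mul_pos hs (sqrt_add_u_pos hmu s)).ne'

theorem continuousOn_actionIntegrand (mu : ℝ) :
    ContinuousOn (fun s => √(mu + u s) / s) (Ioi 0) :=
  (continuous_sqrt_add_u mu).continuousOn.div continuousOn_id fun _ hs => ne_of_gt hs

theorem uIcc_one_subset_Ioi {x : ℝ} (hx : 0 < x) : uIcc 1 x ⊆ Ioi 0 := by
  intro y hy
  exact (lt_min one_pos hx).trans_le hy.1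

theorem timeIntegrand_intervalIntegrable {mu x : ℝ} (hmu : 0 < mu) (hx : 0 < x) :
    IntervalIntegrable (fun s => 1 / (s * √(mu + u s))) volume 1 x :=
  ((continuousOn_timeIntegrand hmu).mono (uIcc_one_subset_Ioi hx)).intervalIntegrable

theorem actionIntegrand_intervalIntegrable (mu : ℝ) {x : ℝ} (hx : 0 < x) :
    IntervalIntegrable (fun s => √(mu + u s) / s) volume 1 x :=
  ((continuousOn_actionIntegrand mu).mono (uIcc_one_subset_Ioi hx)).intervalIntegrable

theorem hasDerivAt_integral_of_continuousOn_Ioi {f : ℝ → ℝ} (hf : ContinuousOn f (Ioi 0)) {x : ℝ}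
    (hx : 0 < x) : HasDerivAt (fun x => ∫ s in (1 : ℝ)..x, f s) (f x) x :=
  intervalIntegral.integral_hasDerivAt_right
    (hf.mono (uIcc_one_subset_Ioi hx)).intervalIntegrable
    (hf.stronglyMeasurableAtFilter isOpen_Ioi _ hx) (hf.continuousAt (isOpen_Ioi.mem_nhds hx))

theorem timeIntegral_pos {R mu : ℝ} (hR : 1 < R) (hmu : 0 < mu) : 0 < timeIntegral R mu :=
  intervalIntegral.intervalIntegral_pos_of_pos_on
    (timeIntegrand_intervalIntegrable hmu (zero_lt_one.trans hR))
    (fun s hs => one_div_pos.2 (mul_pos (zero_lt_one.trans hs.1) (sqrt_add_u_pos hmu s))) hR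

/-- The elementary inequality behind monotonicity in `mu`: raising `mu` moves the ratio
`(mu + U) / (mu + V)` towards `1`, and `r + 1 / r` increases in `r ≥ 1`. -/
theorem sqrt_ratio_add_inv_lt {m m' U V : ℝ} (hm : 0 < m) (hmm : m < m') (hV : 0 ≤ V)
    (hVU : V < U) :
    √(m' + U) / √(m' + V) + √(m' + V) / √(m' + U)
      < √(m + U) / √(m + V) + √(m + V) / √(m + U) := by
  have hm' : 0 < m' := hm.trans hmm
  have a1 : 0 < √(m + V) := Real.sqrt_pos.2 (by linarith)
  have b1 : 0 < √(m' + V) := Real.sqrt_pos.2 (by linarith)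
  have a2 : √(m + V) < √(m + U) := Real.sqrt_lt_sqrt (by linarith) (by linarith)
  have b2 : √(m' + V) < √(m' + U) := Real.sqrt_lt_sqrt (by linarith) (by linarith)
  have key : √(m' + U) * √(m + V) < √(m + U) * √(m' + V) := by
    rw [← Real.sqrt_mul (by linarith), ← Real.sqrt_mul (by linarith)]
    exact Real.sqrt_lt_sqrt (by apply mul_nonneg <;> linarith) (by nlinarith)
  set r := √(m + U) / √(m + V) with hr
  set r' := √(m' + U) / √(m' + V) with hr'
  have h1 : 1 < r' := (one_lt_div b1).2 b2
  have h2 : r' < r := (div_lt_div_iff₀ b1 a1).2 key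
  have e1 : √(m + V) / √(m + U) = r⁻¹ := by rw [hr, inv_div]
  have e2 : √(m' + V) / √(m' + U) = r'⁻¹ := by rw [hr', inv_div]
  rw [e1, e2]
  have hpos : 0 < r' := by linarith
  have hpos' : 0 < r := by linarith
  have : r + r⁻¹ - (r' + r'⁻¹) = (r - r') * (1 - (r * r')⁻¹) := by
    field_simp
    ring
  have h3 : (r * r')⁻¹ < 1 := inv_lt_one_of_one_lt₀ (by nlinarith)
  nlinarith [mul_pos (sub_pos.2 h2) (sub_pos.2 h3)]

theorem integral_kernel {mu x : ℝ} (hmu : 0 < mu) (hx : 1 < x) :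
    ∫ s in (1 : ℝ)..x, 1 / s * (√(mu + u x) / √(mu + u s) + √(mu + u s) / √(mu + u x))
      = √(mu + u x) * timeIntegral x mu + actionIntegral x mu / √(mu + u x) := by
  have hx0 : 0 < x := zero_lt_one.trans hx
  rw [timeIntegral, actionIntegral, ← intervalIntegral.integral_const_mul,
    ← intervalIntegral.integral_div, ← intervalIntegral.integral_add]
  · refine intervalIntegral.integral_congr fun s hs => ?_
    have hs0 : 0 < s := uIcc_one_subset_Ioi hx0 hs
    have := sqrt_add_u_pos hmu s
    have := sqrt_add_u_pos hmu x
    field_simp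
  · exact (timeIntegrand_intervalIntegrable hmu hx0).const_mul _
  · exact (actionIntegrand_intervalIntegrable mu hx0).div_const _

theorem kernel_intervalIntegrable {mu x : ℝ} (hmu : 0 < mu) (hx : 1 < x) :
    IntervalIntegrable
      (fun s => 1 / s * (√(mu + u x) / √(mu + u s) + √(mu + u s) / √(mu + u x))) volume 1 x := by
  refine ContinuousOn.intervalIntegrable ?_
  have hs := (continuous_sqrt_add_u mu).continuousOn (s := uIcc 1 x)
  refine (continuousOn_const.div continuousOn_id fun s hs =>
    ne_of_gt (uIcc_one_subset_Ioi (zero_lt_one.trans hx) hs)).mul (ContinuousOn.add ?_ ?_)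
  · exact continuousOn_const.div hs fun s _ => (sqrt_add_u_pos hmu s).ne'
  · exact hs.div_const _

/-- The difference of the products at two parameters vanishes for `R = 1` and has a positive
derivative in `R`. -/
theorem product_strictAntiOn {R : ℝ} (hR : 1 < R) :
    StrictAntiOn (fun mu => actionIntegral R mu * timeIntegral R mu) (Ioi 0) := by
  intro m hm m' hm' hmm
  rw [mem_Ioi] at hm hm'
  let D : ℝ → ℝ := fun x =>
    actionIntegral x m * timeIntegral x m - actionIntegral x m' * timeIntegral x m'
  have hder : ∀ x, 0 < x → HasDerivAt D
      ((√(m + u x) / x * timeIntegral x m + actionIntegral x m * (1 / (x * √(m + u x)))) -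
       (√(m' + u x) / x * timeIntegral x m' + actionIntegral x m' * (1 / (x * √(m' + u x))))) x := by
    intro x hx
    exact ((hasDerivAt_integral_of_continuousOn_Ioi (continuousOn_actionIntegrand m) hx).mul
      (hasDerivAt_integral_of_continuousOn_Ioi (continuousOn_timeIntegrand hm) hx)).sub
      ((hasDerivAt_integral_of_continuousOn_Ioi (continuousOn_actionIntegrand m') hx).mul
      (hasDerivAt_integral_of_continuousOn_Ioi (continuousOn_timeIntegrand hm') hx))
  have hmono : StrictMonoOn D (Ici 1) := by
    refine strictMonoOn_of_deriv_pos (convex_Ici 1)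
      (fun x hx => (hder x (zero_lt_one.trans_le hx)).continuousAt.continuousWithinAt) ?_
    intro x hx
    rw [interior_Ici, mem_Ioi] at hx
    have hx0 : 0 < x := zero_lt_one.trans hx
    rw [(hder x hx0).deriv]
    have hlt : ∫ s in (1 : ℝ)..x,
          1 / s * (√(m' + u x) / √(m' + u s) + √(m' + u s) / √(m' + u x))
        < ∫ s in (1 : ℝ)..x, 1 / s * (√(m + u x) / √(m + u s) + √(m + u s) / √(m + u x)) := by
      rw [← sub_pos, ← intervalIntegral.integral_sub (kernel_intervalIntegrable hm hx)
        (kernel_intervalIntegrable hm' hx)]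
      refine intervalIntegral.intervalIntegral_pos_of_pos_on
        ((kernel_intervalIntegrable hm hx).sub (kernel_intervalIntegrable hm' hx)) ?_ hx
      intro s hs
      have hs0 : 0 < s := zero_lt_one.trans hs.1
      rw [← mul_sub]
      refine mul_pos (one_div_pos.2 hs0) (sub_pos.2 (sqrt_ratio_add_inv_lt hm hmm (u_nonneg s) ?_))
      exact u_strictMonoOn (mem_Ici.2 hs.1.le) (mem_Ici.2 hx.le) hs.2
    rw [integral_kernel hm hx, integral_kernel hm' hx] at hlt
    have e : ∀ k : ℝ, √(k + u x) / x * timeIntegral x k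
        + actionIntegral x k * (1 / (x * √(k + u x)))
        = (√(k + u x) * timeIntegral x k + actionIntegral x k / √(k + u x)) / x := by
      intro k
      rw [add_div, one_div, mul_inv]
      ring
    rw [e, e, ← sub_div]
    exact div_pos (sub_pos.2 hlt) hx0
  have h := hmono (mem_Ici.2 le_rfl) (mem_Ici.2 hR.le) hR
  simp only [D, actionIntegral, timeIntegral, intervalIntegral.integral_same, mul_zero,
    sub_zero, sub_pos] at h
  exact h

theorem integral_one_div_one {R : ℝ} (hR : 1 < R) : ∫ s in (1 : ℝ)..R, 1 / s = Real.log R := by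
  rw [integral_one_div_of_pos one_pos (zero_lt_one.trans hR), div_one]

theorem one_div_intervalIntegrable {R : ℝ} (hR : 1 < R) :
    IntervalIntegrable (fun s : ℝ => 1 / s) volume 1 R :=
  intervalIntegral.intervalIntegrable_one_div
    (fun _ hs => ne_of_gt (uIcc_one_subset_Ioi (zero_lt_one.trans hR) hs)) continuousOn_id

theorem sqrt_add_u_le {R mu s : ℝ} (hs : s ∈ Icc 1 R) : √(mu + u s) ≤ √(mu + u R) := by
  refine Real.sqrt_le_sqrt ?_
  have := u_strictMonoOn.monotoneOn (mem_Ici.2 hs.1) (mem_Ici.2 (hs.1.trans hs.2)) hs.2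
  linarith

theorem sqrt_le_sqrt_add_u (mu s : ℝ) : √mu ≤ √(mu + u s) :=
  Real.sqrt_le_sqrt (by linarith [u_nonneg s])

theorem actionIntegral_bounds {R mu : ℝ} (hR : 1 < R) :
    √mu * Real.log R ≤ actionIntegral R mu ∧
      actionIntegral R mu ≤ √(mu + u R) * Real.log R := by
  have hint := actionIntegrand_intervalIntegrable mu (zero_lt_one.trans hR)
  rw [← integral_one_div_one hR, ← intervalIntegral.integral_const_mul,
    ← intervalIntegral.integral_const_mul]
  constructor
  · refine intervalIntegral.integral_mono_on hR.le ((one_div_intervalIntegrable hR).const_mul _)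
      hint fun s hs => ?_
    have hs0 : 0 < s := zero_lt_one.trans_le hs.1
    rw [mul_one_div]
    exact div_le_div_of_nonneg_right (sqrt_le_sqrt_add_u mu s) hs0.le
  · refine intervalIntegral.integral_mono_on hR.le
      hint ((one_div_intervalIntegrable hR).const_mul _) fun s hs => ?_
    have hs0 : 0 < s := zero_lt_one.trans_le hs.1
    rw [mul_one_div]
    exact div_le_div_of_nonneg_right (sqrt_add_u_le hs) hs0.le

theorem timeIntegral_bounds {R mu : ℝ} (hR : 1 < R) (hmu : 0 < mu) :
    (√(mu + u R))⁻¹ * Real.log R ≤ timeIntegral R mu ∧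
      timeIntegral R mu ≤ (√mu)⁻¹ * Real.log R := by
  have hint := timeIntegrand_intervalIntegrable hmu (zero_lt_one.trans hR)
  rw [← integral_one_div_one hR, ← intervalIntegral.integral_const_mul,
    ← intervalIntegral.integral_const_mul]
  have e : ∀ a s : ℝ, 1 / (s * a) = a⁻¹ * (1 / s) := fun a s => by
    rw [one_div, mul_inv, one_div, mul_comm]
  constructor
  · refine intervalIntegral.integral_mono_on hR.le ((one_div_intervalIntegrable hR).const_mul _)
      hint fun s hs => ?_
    have hs0 : 0 < s := zero_lt_one.trans_le hs.1
    rw [e]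
    exact mul_le_mul_of_nonneg_right
      (inv_anti₀ (sqrt_add_u_pos hmu s) (sqrt_add_u_le hs)) (one_div_pos.2 hs0).le
  · refine intervalIntegral.integral_mono_on hR.le
      hint ((one_div_intervalIntegrable hR).const_mul _) fun s hs => ?_
    have hs0 : 0 < s := zero_lt_one.trans_le hs.1
    rw [e]
    exact mul_le_mul_of_nonneg_right
      (inv_anti₀ (Real.sqrt_pos.2 hmu) (sqrt_le_sqrt_add_u mu s)) (one_div_pos.2 hs0).le

theorem product_tendsto_atTop {R : ℝ} (hR : 1 < R) :
    Tendsto (fun mu => actionIntegral R mu * timeIntegral R mu) atTop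
      (𝓝 (Real.log R ^ 2)) := by
  have hL : 0 < Real.log R := Real.log_pos hR
  have hratio : Tendsto (fun mu : ℝ => √(mu + u R) * (√mu)⁻¹) atTop (𝓝 1) := by
    have h1 : Tendsto (fun mu : ℝ => √(1 + u R / mu)) atTop (𝓝 √(1 + 0)) :=
      (Real.continuous_sqrt.tendsto _).comp
        (tendsto_const_nhds.add (tendsto_const_nhds.div_atTop tendsto_id))
    rw [add_zero, Real.sqrt_one] at h1
    refine h1.congr' ?_
    filter_upwards [eventually_gt_atTop 0] with mu hmu
    rw [← div_eq_mul_inv, ← Real.sqrt_div (add_u_pos hmu R).le, add_div, div_self hmu.ne']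
  have hup := hratio.mul_const (Real.log R ^ 2)
  have hlo := (hratio.inv₀ one_ne_zero).mul_const (Real.log R ^ 2)
  rw [one_mul] at hup
  rw [inv_one, one_mul] at hlo
  refine tendsto_of_tendsto_of_tendsto_of_le_of_le' hlo hup ?_ ?_
  · filter_upwards [eventually_gt_atTop 0] with mu hmu
    obtain ⟨a, -⟩ := actionIntegral_bounds (mu := mu) hR
    obtain ⟨b, -⟩ := timeIntegral_bounds hR hmu
    have hs := Real.sqrt_pos.2 hmu
    have hs' := sqrt_add_u_pos hmu R
    calc (√(mu + u R) * (√mu)⁻¹)⁻¹ * Real.log R ^ 2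
        = (√mu * Real.log R) * ((√(mu + u R))⁻¹ * Real.log R) := by
          rw [mul_inv, inv_inv]; ring
      _ ≤ _ := mul_le_mul a b (by positivity) ((by positivity : (0 : ℝ) ≤ _).trans a)
  · filter_upwards [eventually_gt_atTop 0] with mu hmu
    obtain ⟨-, a⟩ := actionIntegral_bounds (mu := mu) hR
    obtain ⟨-, b⟩ := timeIntegral_bounds hR hmu
    calc actionIntegral R mu * timeIntegral R mu
        ≤ (√(mu + u R) * Real.log R) * ((√mu)⁻¹ * Real.log R) :=
          mul_le_mul a b (timeIntegral_pos hR hmu).le (by positivity)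
      _ = _ := by ring

/-- `√u` vanishes to first order at `s = 1`, which makes the time integral diverge
logarithmically as `mu → 0`. -/
theorem log_le_timeIntegral {R mu : ℝ} (hR : 1 < R) (hmu : 0 < mu) :
    (R * (R + 2))⁻¹ * (Real.log ((R + 2) * (R - 1)) - Real.log √mu) ≤ timeIntegral R mu := by
  have hsm := Real.sqrt_pos.2 hmu
  have hC : 0 < R + 2 := by linarith
  have hR0 : 0 < R := by linarith
  have hpos : ∀ s ∈ uIcc 1 R, 0 < √mu + (R + 2) * (s - 1) := by
    intro s hs
    rw [uIcc_of_le hR.le] at hs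
    have : 0 ≤ (R + 2) * (s - 1) := mul_nonneg hC.le (by linarith [hs.1])
    linarith
  have hcont : ContinuousOn (fun s => (R * (√mu + (R + 2) * (s - 1)))⁻¹) (uIcc 1 R) :=
    ContinuousOn.inv₀ (by fun_prop) fun s hs => (mul_pos hR0 (hpos s hs)).ne'
  have hint : ∫ s in (1 : ℝ)..R, (R * (√mu + (R + 2) * (s - 1)))⁻¹
      = (R * (R + 2))⁻¹ * (Real.log (√mu + (R + 2) * (R - 1)) - Real.log √mu) := by
    rw [intervalIntegral.integral_eq_sub_of_hasDerivAt
      (f := fun s => (R * (R + 2))⁻¹ * Real.log (√mu + (R + 2) * (s - 1))) _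
      hcont.intervalIntegrable]
    · simp only [sub_self, mul_zero, add_zero]; ring
    · intro s hs
      have h1 : HasDerivAt (fun s => √mu + (R + 2) * (s - 1)) ((R + 2) * 1) s :=
        (((hasDerivAt_id s).sub_const 1).const_mul (R + 2)).const_add _
      have h2 := (h1.log (hpos s hs).ne').const_mul (R * (R + 2))⁻¹
      refine h2.congr_deriv ?_
      rw [mul_one, div_eq_mul_inv, mul_inv, mul_inv]
      field_simp
  have hle : (R * (R + 2))⁻¹ * (Real.log ((R + 2) * (R - 1)) - Real.log √mu)
      ≤ ∫ s in (1 : ℝ)..R, (R * (√mu + (R + 2) * (s - 1)))⁻¹ := by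
    rw [hint]
    have h0 : 0 < (R + 2) * (R - 1) := mul_pos hC (by linarith)
    have := Real.log_le_log h0 (by linarith : (R + 2) * (R - 1) ≤ √mu + (R + 2) * (R - 1))
    exact mul_le_mul_of_nonneg_left (by linarith) (by positivity)
  refine hle.trans (intervalIntegral.integral_mono_on hR.le hcont.intervalIntegrable
    (timeIntegrand_intervalIntegrable hmu hR0) fun s hs => ?_)
  have hs0 : 0 < s := zero_lt_one.trans_le hs.1
  rw [one_div]
  refine inv_anti₀ (mul_pos hs0 (sqrt_add_u_pos hmu s)) ?_
  refine mul_le_mul hs.2 ?_ (Real.sqrt_nonneg _) hR0.le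
  have hnn : 0 ≤ (R + 2) * (s - 1) := mul_nonneg hC.le (by linarith [hs.1])
  refine Real.sqrt_le_iff.2 ⟨by linarith, ?_⟩
  have h1 : u s ≤ ((R + 2) * (s - 1)) ^ 2 := by
    have e : ((R + 2) * (s - 1)) ^ 2 - u s = (s - 1) ^ 2 * ((R + 2) ^ 2 - (s + 1) ^ 2 - 1) := by
      unfold u; ring
    have : 0 ≤ (R + 2) ^ 2 - (s + 1) ^ 2 - 1 := by nlinarith [hs.1, hs.2]
    nlinarith [mul_nonneg (sq_nonneg (s - 1)) this]
  nlinarith [Real.sq_sqrt hmu.le, mul_nonneg hsm.le hnn]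

theorem product_tendsto_zero {R : ℝ} (hR : 1 < R) :
    Tendsto (fun mu => actionIntegral R mu * timeIntegral R mu) (𝓝[>] 0) atTop := by
  have hR0 : 0 < R := zero_lt_one.trans hR
  have hS0 : 0 < actionIntegral R 0 := by
    refine intervalIntegral.intervalIntegral_pos_of_pos_on
      (actionIntegrand_intervalIntegrable 0 hR0) (fun s hs => ?_) hR
    have h1 : u 1 < u s := u_strictMonoOn (mem_Ici.2 le_rfl) (mem_Ici.2 hs.1.le) hs.1
    have h2 := u_nonneg 1
    exact div_pos (Real.sqrt_pos.2 (by linarith)) (zero_lt_one.trans hs.1)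
  have hsqrt : Tendsto (fun mu : ℝ => √mu) (𝓝[>] 0) (𝓝[>] 0) := by
    refine tendsto_nhdsWithin_iff.2 ⟨?_, ?_⟩
    · have := (Real.continuous_sqrt.tendsto 0).mono_left (nhdsWithin_le_nhds (s := Ioi 0))
      rwa [Real.sqrt_zero] at this
    · filter_upwards [self_mem_nhdsWithin] with mu hmu using Real.sqrt_pos.2 hmu
  have hlog := tendsto_neg_atBot_atTop.comp (Real.tendsto_log_nhdsGT_zero.comp hsqrt)
  have hT : Tendsto (fun mu => (R * (R + 2))⁻¹ *
      (Real.log ((R + 2) * (R - 1)) - Real.log √mu)) (𝓝[>] 0) atTop := by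
    refine Tendsto.const_mul_atTop (by positivity) ?_
    simp only [sub_eq_add_neg]
    exact tendsto_atTop_add_const_left _ _ hlog
  have hT' : Tendsto (fun mu => timeIntegral R mu) (𝓝[>] 0) atTop := by
    refine tendsto_atTop_mono' _ ?_ hT
    filter_upwards [self_mem_nhdsWithin] with mu hmu using log_le_timeIntegral hR hmu
  refine tendsto_atTop_mono' _ ?_ (hT'.const_mul_atTop hS0)
  filter_upwards [self_mem_nhdsWithin] with mu hmu
  refine mul_le_mul_of_nonneg_right ?_ (timeIntegral_pos hR hmu).le
  refine intervalIntegral.integral_mono_on hR.le (actionIntegrand_intervalIntegrable 0 hR0)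
    (actionIntegrand_intervalIntegrable mu hR0) fun s hs => ?_
  refine div_le_div_of_nonneg_right (Real.sqrt_le_sqrt ?_) (zero_le_one.trans hs.1)
  have : (0 : ℝ) < mu := hmu
  linarith

theorem product_continuousOn {R : ℝ} (hR : 1 < R) :
    ContinuousOn (fun mu => actionIntegral R mu * timeIntegral R mu) (Ioi 0) := by
  intro m hm
  rw [mem_Ioi] at hm
  refine ContinuousAt.continuousWithinAt (ContinuousAt.mul ?_ ?_)
  · -- truncating `s` and `mu` away from zero makes the integrands jointly continuous
    have hc : Continuous fun mu : ℝ => ∫ s in (1 : ℝ)..R, √(mu + u s) / max s 1 := by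
      refine intervalIntegral.continuous_parametric_intervalIntegral_of_continuous' ?_ _ _
      have := continuous_u
      exact Continuous.div (by fun_prop) (by fun_prop)
        fun p => (zero_lt_one.trans_le (le_max_right _ _)).ne'
    refine hc.continuousAt.congr (Eventually.of_forall fun mu => ?_)
    refine intervalIntegral.integral_congr fun s hs => ?_
    rw [uIcc_of_le hR.le] at hs
    simp only [max_eq_left hs.1]
  · have hc : Continuous fun mu : ℝ =>
        ∫ s in (1 : ℝ)..R, 1 / (max s 1 * √(max mu (m / 2) + u s)) := by
      refine intervalIntegral.continuous_parametric_intervalIntegral_of_continuous' ?_ _ _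
      have := continuous_u
      refine Continuous.div (by fun_prop) (by fun_prop) fun p => ?_
      have : 0 < max p.1 (m / 2) := (half_pos hm).trans_le (le_max_right _ _)
      exact (mul_pos (zero_lt_one.trans_le (le_max_right _ _)) (sqrt_add_u_pos this _)).ne'
    refine hc.continuousAt.congr ?_
    filter_upwards [lt_mem_nhds (half_lt_self hm)] with mu hmu
    refine intervalIntegral.integral_congr fun s hs => ?_
    rw [uIcc_of_le hR.le] at hs
    simp only [max_eq_left hs.1, max_eq_left hmu.le]

theorem exists_solvesSystem {R A : ℝ} (hR : 1 < R) (hA : Real.log R ^ 2 < A) :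
    ∃ lam mu : ℝ, SolvesSystem R A lam mu ∧
      ∀ lam' mu' : ℝ, SolvesSystem R A lam' mu' → lam' = lam ∧ mu' = mu := by
  obtain ⟨m₁, hm₁, hm₁'⟩ := (((product_tendsto_zero hR).eventually_ge_atTop A).and
    self_mem_nhdsWithin).exists
  obtain ⟨m₂, hm₂, hm₂'⟩ := (((product_tendsto_atTop hR).eventually (gt_mem_nhds hA)).and
    (eventually_gt_atTop 0)).exists
  obtain ⟨mu, hmu, hprod⟩ := intermediate_value_uIcc
    ((product_continuousOn hR).mono (fun x hx => (lt_min hm₁' hm₂').trans_le hx.1 :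
      uIcc m₁ m₂ ⊆ Ioi 0)) (mem_uIcc.2 (Or.inr ⟨hm₂.le, hm₁⟩))
  have hmu0 : 0 < mu := (lt_min hm₁' hm₂').trans_le hmu.1
  have hT := timeIntegral_pos hR hmu0
  simp only at hprod
  refine ⟨(timeIntegral R mu ^ 2)⁻¹, mu, ⟨by positivity, hmu0, ?_, ?_⟩, ?_⟩
  · rw [Real.sqrt_inv, Real.sqrt_sq hT.le, one_div, inv_inv]
  · rw [Real.sqrt_inv, Real.sqrt_sq hT.le, one_div, inv_inv, mul_comm, hprod]
  · rintro lam' mu' ⟨hl, hm, h1, h2⟩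
    have hmm : mu' = mu := by
      refine (product_strictAntiOn hR).injOn hm hmu0 ?_
      rw [hprod, h1, mul_comm, h2]
    subst hmm
    refine ⟨?_, rfl⟩
    rw [h1, one_div, inv_pow, inv_inv, Real.sq_sqrt hl.le]

/-! ### The first-order equation -/

/-- The flow of an autonomous equation `ψ' = V(ψ)` with `V` continuous and pinched between positive
constants is the inverse function of `x ↦ ∫_a^x 1 / V`. -/
theorem exists_autonomous_solution {V : ℝ → ℝ} (hV : Continuous V) {m M : ℝ} (hm : 0 < m)
    (hmV : ∀ x, m ≤ V x) (hVM : ∀ x, V x ≤ M) (a : ℝ) :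
    ∃ ψ : ℝ → ℝ, StrictMono ψ ∧ (∀ t, HasDerivAt ψ (V (ψ t)) t) ∧
      ∀ b, ψ (∫ x in a..b, (V x)⁻¹) = b := by
  have hVpos : ∀ x, 0 < V x := fun x => hm.trans_le (hmV x)
  have hM : 0 < M := (hVpos 0).trans_le (hVM 0)
  have hinv : Continuous fun x => (V x)⁻¹ := hV.inv₀ fun x => (hVpos x).ne'
  let Φ : ℝ → ℝ := fun x => ∫ y in a..x, (V y)⁻¹
  have hΦ : ∀ x, HasDerivAt Φ (V x)⁻¹ x := fun x => hinv.integral_hasStrictDerivAt a x |>.hasDerivAt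
  have hmono : StrictMono Φ := strictMono_of_deriv_pos fun x => by
    rw [(hΦ x).deriv]; exact inv_pos.2 (hVpos x)
  have hcont : Continuous Φ := continuous_iff_continuousAt.2 fun x => (hΦ x).continuousAt
  have hΨ : ∀ x, HasDerivAt (fun x => Φ x - M⁻¹ * x) ((V x)⁻¹ - M⁻¹ * 1) x := fun x =>
    (hΦ x).sub ((hasDerivAt_id x).const_mul _)
  have hmono' : Monotone fun x => Φ x - M⁻¹ * x :=
    monotone_of_deriv_nonneg (fun x => (hΨ x).differentiableAt) fun x => by
      rw [(hΨ x).deriv, mul_one, sub_nonneg]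
      exact inv_anti₀ (hVpos x) (hVM x)
  have hM' : 0 < M⁻¹ := inv_pos.2 hM
  have htop : Tendsto Φ atTop atTop := by
    refine tendsto_atTop_mono' _ ?_
      (tendsto_atTop_add_const_left _ (Φ 0) (tendsto_id.const_mul_atTop hM'))
    filter_upwards [eventually_ge_atTop 0] with x hx
    have := hmono' hx
    simp only [mul_zero, sub_zero] at this
    simp only [id]
    linarith
  have hbot : Tendsto Φ atBot atBot := by
    refine tendsto_atBot_mono' _ ?_
      (tendsto_atBot_add_const_left _ (Φ 0) (tendsto_id.const_mul_atBot hM'))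
    filter_upwards [eventually_le_atBot 0] with x hx
    have := hmono' hx
    simp only [mul_zero, sub_zero] at this
    simp only [id]
    linarith
  have hsurj := hcont.surjective htop hbot
  let e := hmono.orderIsoOfSurjective Φ hsurj
  have he : ∀ y, Φ (e.symm y) = y := fun y => e.apply_symm_apply y
  refine ⟨e.symm, e.symm.strictMono, fun t => ?_, fun b => e.symm_apply_apply b⟩
  have := HasDerivAt.of_local_left_inverse (f := Φ) (g := e.symm) (a := t)
    e.symm.continuous.continuousAt (hΦ _) (inv_pos.2 (hVpos _)).ne' (Eventually.of_forall he)
  rwa [inv_inv] at this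

/-- The derivative of `u`. -/
def du (s : ℝ) : ℝ := 4 * s * (s ^ 2 - 1) + 2 * (s - 1)

theorem hasDerivAt_u (s : ℝ) : HasDerivAt u (du s) s := by
  have h1 : HasDerivAt (fun s : ℝ => s ^ 2 - 1) (2 * s) s := by
    simpa using (hasDerivAt_pow 2 s).sub_const 1
  have h2 := (h1.pow 2).add (((hasDerivAt_id s).sub_const 1).pow 2)
  refine h2.congr_deriv ?_
  simp only [du, id]
  push_cast
  ring

theorem continuous_du : Continuous du := by unfold du; fun_prop

/-- A radius function that solves the first-order equation with constants `lam`, `mu` on `[0,1]` and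
connects the values `1` and `R`. The regularity beyond `[0,1]` is that of the solution of the
equation whose right-hand side is frozen outside `[1,R]`. -/
structure IsProfile (R lam mu : ℝ) (ψ : ℝ → ℝ) : Prop where
  strictMono : StrictMono ψ
  contDiff : ContDiff ℝ 1 ψ
  zero : ψ 0 = 1
  one : ψ 1 = R
  hasDerivAt : ∀ t ∈ Icc (0 : ℝ) 1, HasDerivAt ψ (1 / √lam * ψ t * √(mu + u (ψ t))) t

theorem exists_isProfile {R lam mu : ℝ} (hR : 1 < R) (hlam : 0 < lam) (hmu : 0 < mu)
    (hT : timeIntegral R mu = 1 / √lam) : ∃ ψ, IsProfile R lam mu ψ := by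
  have hsl := Real.sqrt_pos.2 hlam
  have hsm := Real.sqrt_pos.2 hmu
  let c : ℝ → ℝ := fun x => max 1 (min x R)
  have hc : Continuous c := by fun_prop
  have hc1 : ∀ x, 1 ≤ c x := fun x => le_max_left _ _
  have hcR : ∀ x, c x ≤ R := fun x => max_le hR.le (min_le_right _ _)
  have hcid : ∀ x ∈ Icc 1 R, c x = x := fun x hx => by
    simp only [c, min_eq_left hx.2, max_eq_right hx.1]
  let V : ℝ → ℝ := fun x => 1 / √lam * c x * √(mu + u (c x))
  have hV : Continuous V := (continuous_const.mul hc).mul ((continuous_sqrt_add_u mu).comp hc)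
  have hmV : ∀ x, 1 / √lam * 1 * √mu ≤ V x := fun x => by
    have := hc1 x
    have := sqrt_le_sqrt_add_u mu (c x)
    simp only [V]; gcongr
  have hVM : ∀ x, V x ≤ 1 / √lam * R * √(mu + u R) := fun x => by
    have h1 := hcR x
    have := sqrt_add_u_le (R := R) (mu := mu) ⟨hc1 x, h1⟩
    have : 0 ≤ 1 / √lam * R := by positivity
    simp only [V]; gcongr
  obtain ⟨ψ, hmono, hder, hinv⟩ := exists_autonomous_solution hV (by positivity) hmV hVM 1
  have h0 : ψ 0 = 1 := by simpa using hinv 1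
  have h1 : ψ 1 = R := by
    have : ∫ x in (1 : ℝ)..R, (V x)⁻¹ = 1 := by
      have e : ∫ x in (1 : ℝ)..R, (V x)⁻¹ = √lam * timeIntegral R mu := by
        rw [timeIntegral, ← intervalIntegral.integral_const_mul]
        refine intervalIntegral.integral_congr fun s hs => ?_
        rw [uIcc_of_le hR.le] at hs
        simp only [V, hcid s hs]
        rw [mul_assoc, mul_inv, one_div, inv_inv, one_div]
      rw [e, hT, mul_one_div_cancel hsl.ne']
    rw [← this]; exact hinv R
  refine ⟨ψ, hmono, ?_, h0, h1, fun t ht => ?_⟩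
  · rw [contDiff_one_iff_deriv]
    refine ⟨fun t => (hder t).differentiableAt, ?_⟩
    have : deriv ψ = V ∘ ψ := funext fun t => (hder t).deriv
    rw [this]
    exact hV.comp (continuous_iff_continuousAt.2 fun t => (hder t).continuousAt)
  · have hmem : ψ t ∈ Icc 1 R := by
      rw [← h0, ← h1]; exact ⟨hmono.monotone ht.1, hmono.monotone ht.2⟩
    have := hder t
    simp only [V, hcid _ hmem] at this
    exact this

/-- The Euler–Lagrange equation of `J + lam G` in weak form. The variation is written as `ψ k`, which
turns the variation of `log ψ` into `k`. -/
def WeakEulerLagrange (lam : ℝ) (ψ : ℝ → ℝ) : Prop :=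
  ∀ k : ℝ → ℝ, MemW012 k →
    (∫ t in (0 : ℝ)..1, du (ψ t) * ψ t * k t) +
      2 * lam * ∫ t in (0 : ℝ)..1, deriv ψ t / ψ t * deriv k t = 0

namespace IsProfile

variable {R lam mu : ℝ} {ψ : ℝ → ℝ}

theorem mem_Icc (h : IsProfile R lam mu ψ) {t : ℝ} (ht : t ∈ Icc (0 : ℝ) 1) : ψ t ∈ Icc 1 R := by
  rw [← h.zero, ← h.one]; exact ⟨h.strictMono.monotone ht.1, h.strictMono.monotone ht.2⟩

theorem pos (h : IsProfile R lam mu ψ) {t : ℝ} (ht : t ∈ Icc (0 : ℝ) 1) : 0 < ψ t :=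
  zero_lt_one.trans_le (h.mem_Icc ht).1

theorem absCont (h : IsProfile R lam mu ψ) : AbsolutelyContinuousOnInterval ψ 0 1 :=
  h.contDiff.contDiffOn.absolutelyContinuousOnInterval

theorem contDiffOn (h : IsProfile R lam mu ψ) (hmu : 0 < mu) : ContDiffOn ℝ 2 ψ (Ioo 0 1) := by
  have h2 : (2 : WithTop ℕ∞) = 1 + 1 := by norm_num
  rw [h2, contDiffOn_succ_iff_deriv_of_isOpen isOpen_Ioo]
  refine ⟨h.contDiff.differentiable_one.differentiableOn, by simp, ?_⟩
  have hs : ContDiff ℝ 1 fun t => √(mu + u (ψ t)) :=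
    (contDiff_const.add (contDiff_u.comp h.contDiff)).sqrt fun t => (add_u_pos hmu _).ne'
  refine ContDiffOn.congr
    (f := fun t => 1 / √lam * ψ t * √(mu + u (ψ t))) ?_ fun t ht =>
      (h.hasDerivAt t (Ioo_subset_Icc_self ht)).deriv
  exact ((contDiff_const.mul h.contDiff).mul hs).contDiffOn

theorem logDeriv (h : IsProfile R lam mu ψ) {t : ℝ} (ht : t ∈ Icc (0 : ℝ) 1) :
    deriv ψ t / ψ t = √(mu + u (ψ t)) / √lam := by
  rw [(h.hasDerivAt t ht).deriv]
  have := (h.pos ht).ne'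
  field_simp

theorem memW12 (h : IsProfile R lam mu ψ) : MemW12 ψ := by
  refine ⟨h.absCont, ?_⟩
  have hc : ContinuousOn (deriv ψ) (Icc 0 1) := (h.contDiff.continuous_deriv le_rfl).continuousOn
  rw [memLp_two_iff_integrable_sq (aestronglyMeasurable_unit hc)]
  exact intervalIntegrable_unit.1 (intervalIntegrable_of_continuousOn_unit (hc.pow 2))

theorem mem_Q12 (h : IsProfile R lam mu ψ) : ψ ∈ Q12 R := ⟨h.memW12, h.zero, h.one⟩

theorem finiteG (h : IsProfile R lam mu ψ) : FiniteG ψ :=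
  finiteG_of_memW12 h.memW12 fun _ => h.pos

theorem mem_Qplus (h : IsProfile R lam mu ψ) (hmu : 0 < mu) : ψ ∈ Qplus R :=
  ⟨h.contDiffOn hmu, h.contDiff.continuous.continuousOn, h.zero, h.one,
    h.strictMono.strictMonoOn _⟩

/-- Along a profile `(ψ'/ψ)² dt = √(mu + u(ψ)) / (√lam ψ) dψ`. -/
theorem integral_logDeriv_sq (h : IsProfile R lam mu ψ) :
    ∫ t in (0 : ℝ)..1, (deriv ψ t / ψ t) ^ 2 = 1 / √lam * actionIntegral R mu := by
  have hsub := intervalIntegral.integral_comp_mul_deriv'' (a := 0) (b := 1) (f := ψ)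
    (f' := deriv ψ) (g := fun s => √(mu + u s) / s) h.contDiff.continuous.continuousOn
    (fun t _ => (h.contDiff.differentiable_one t).hasDerivAt.hasDerivWithinAt)
    (h.contDiff.continuous_deriv le_rfl).continuousOn
    ((continuousOn_actionIntegrand mu).mono (by
      rintro _ ⟨t, ht, rfl⟩
      rw [uIcc_of_le zero_le_one] at ht
      exact h.pos ht))
  rw [h.zero, h.one] at hsub
  rw [actionIntegral, ← hsub, ← intervalIntegral.integral_const_mul]
  refine intervalIntegral.integral_congr fun t ht => ?_
  rw [uIcc_of_le zero_le_one] at ht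
  have e := h.logDeriv ht
  simp only [Function.comp]
  calc (deriv ψ t / ψ t) ^ 2 = √(mu + u (ψ t)) / √lam * (deriv ψ t / ψ t) := by rw [pow_two, e]
    _ = _ := by ring

theorem weakEulerLagrange (h : IsProfile R lam mu ψ) (hlam : 0 < lam) (hmu : 0 < mu) :
    WeakEulerLagrange lam ψ := by
  rintro k ⟨⟨hk, -⟩, hk0, hk1⟩
  have hp : AbsolutelyContinuousOnInterval (fun t => √(mu + u (ψ t)) / √lam) 0 1 := by
    have hs : ContDiff ℝ 1 fun t => √(mu + u (ψ t)) :=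
      (contDiff_const.add (contDiff_u.comp h.contDiff)).sqrt fun t => (add_u_pos hmu _).ne'
    exact (hs.div_const _).contDiffOn.absolutelyContinuousOnInterval
  have hparts := hp.integral_mul_deriv_eq_deriv_mul hk
  rw [hk0, hk1, mul_zero, mul_zero, sub_zero, zero_sub] at hparts
  have e1 : ∫ t in (0 : ℝ)..1, deriv ψ t / ψ t * deriv k t
      = ∫ t in (0 : ℝ)..1, √(mu + u (ψ t)) / √lam * deriv k t := by
    refine intervalIntegral.integral_congr fun t ht => ?_
    rw [uIcc_of_le zero_le_one] at ht
    simp only [h.logDeriv ht]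
  have e2 : ∫ t in (0 : ℝ)..1, deriv (fun t => √(mu + u (ψ t)) / √lam) t * k t
      = ∫ t in (0 : ℝ)..1, (2 * lam)⁻¹ * (du (ψ t) * ψ t * k t) := by
    refine intervalIntegral.integral_congr fun t ht => ?_
    rw [uIcc_of_le zero_le_one] at ht
    have hs := sqrt_add_u_pos hmu (ψ t)
    have hl := Real.sqrt_pos.2 hlam
    have hd := ((((hasDerivAt_u (ψ t)).comp t (h.hasDerivAt t ht)).const_add mu).sqrt
      (add_u_pos hmu _).ne').div_const √lam
    have hd' := hd.deriv
    simp only [Function.comp] at hd'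
    simp only [hd']
    have hll : √lam * √lam = lam := Real.mul_self_sqrt hlam.le
    nth_rewrite 3 [← hll]
    field_simp
  rw [e1, hparts, e2, intervalIntegral.integral_const_mul]
  field_simp
  ring

end IsProfile

/-! ### The first variation -/

theorem MemW12.mul {f g : ℝ → ℝ} (hf : MemW12 f) (hg : MemW12 g) :
    MemW12 (fun t => f t * g t) := by
  refine ⟨hf.1.fun_mul hg.1, ?_⟩
  refine MemLp.ae_eq ?_ ((memLp_two_continuousOn_mul (continuousOn_unit hg.1) hf.2).add
    (memLp_two_continuousOn_mul (continuousOn_unit hf.1) hg.2))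
  filter_upwards [ae_unit_differentiableAt hf.1, ae_unit_differentiableAt hg.1] with t h1 h2
  simp only [Pi.add_apply]
  rw [deriv_fun_mul h1 h2]
  ring

theorem MemW12.inv {f : ℝ → ℝ} (hf : MemW12 f) (hpos : ∀ t ∈ Icc (0 : ℝ) 1, 0 < f t) :
    MemW12 (fun t => (f t)⁻¹) := by
  refine ⟨hf.1.inv (by rwa [uIcc_of_le zero_le_one]), ?_⟩
  have hc : ContinuousOn (fun t => -(f t ^ 2)⁻¹) (Icc 0 1) :=
    (((continuousOn_unit hf.1).pow 2).inv₀ fun t ht => (pow_pos (hpos t ht) 2).ne').neg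
  refine MemLp.ae_eq ?_ (memLp_two_continuousOn_mul hc hf.2)
  filter_upwards [ae_unit_differentiableAt hf.1, ae_restrict_mem measurableSet_Ioo] with t h1 h2
  rw [deriv_fun_inv'' h1 (hpos t (Ioo_subset_Icc_self h2)).ne']
  field_simp

theorem J_eq_integral_u {φ : ℝ → ℝ} (hφ : ContinuousOn φ (Icc 0 1)) :
    J φ = ∫ t in (0 : ℝ)..1, u (φ t) := by
  unfold J u
  rw [intervalIntegral.integral_add] <;>
    exact intervalIntegrable_of_continuousOn_unit (by fun_prop)

theorem hasDerivAt_J {φ h : ℝ → ℝ} (hφ : ContinuousOn φ (Icc 0 1))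
    (hh : ContinuousOn h (Icc 0 1)) :
    HasDerivAt (fun ε : ℝ => J (fun t => φ t + ε * h t))
      (∫ t in (0 : ℝ)..1, du (φ t) * h t) 0 := by
  have hcont : ∀ ε : ℝ, ContinuousOn (fun t => φ t + ε * h t) (Icc 0 1) := fun ε => by fun_prop
  have hJ : (fun ε : ℝ => J (fun t => φ t + ε * h t))
      = fun ε => ∫ t in (0 : ℝ)..1, u (φ t + ε * h t) :=
    funext fun ε => J_eq_integral_u (hcont ε)
  rw [hJ]
  obtain ⟨C, hC⟩ := isCompact_Icc.exists_bound_of_continuousOn hφ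
  obtain ⟨D, hD⟩ := isCompact_Icc.exists_bound_of_continuousOn hh
  obtain ⟨B, hB⟩ := (isCompact_Icc (a := -(C + D)) (b := C + D)).exists_bound_of_continuousOn
    continuous_du.continuousOn
  have hD0 : 0 ≤ D := (norm_nonneg _).trans (hD 0 (left_mem_Icc.2 zero_le_one))
  have hsub : uIoc (0 : ℝ) 1 ⊆ Icc 0 1 := by
    rw [uIoc_of_le zero_le_one]; exact Ioc_subset_Icc_self
  have hmeas : ∀ f : ℝ → ℝ, ContinuousOn f (Icc 0 1) →
      AEStronglyMeasurable f (volume.restrict (uIoc (0 : ℝ) 1)) := fun f hf =>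
    (hf.mono hsub).aestronglyMeasurable measurableSet_uIoc
  have key := intervalIntegral.hasDerivAt_integral_of_dominated_loc_of_deriv_le
    (F := fun ε t => u (φ t + ε * h t)) (F' := fun ε t => du (φ t + ε * h t) * h t)
    (x₀ := (0 : ℝ)) (s := Metric.ball 0 1) (a := 0) (b := 1) (μ := volume)
    (bound := fun _ => B * D) (Metric.ball_mem_nhds 0 one_pos)
    (Eventually.of_forall fun ε => hmeas _ (continuous_u.comp_continuousOn (hcont ε)))
    (intervalIntegrable_of_continuousOn_unit (continuous_u.comp_continuousOn (hcont 0)))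
    (hmeas _ ((continuous_du.comp_continuousOn (hcont 0)).mul hh))
    (Eventually.of_forall fun t ht ε hε => ?_) intervalIntegrable_const
    (Eventually.of_forall fun t ht ε hε => ?_)
  · simpa using key.2
  · rw [norm_mul]
    have h1 := hC t (hsub ht)
    have h2 := hD t (hsub ht)
    rw [Real.norm_eq_abs] at h1 h2
    rw [mem_ball_zero_iff, Real.norm_eq_abs] at hε
    have h3 : |φ t + ε * h t| ≤ C + D := by
      refine (abs_add_le _ _).trans (add_le_add h1 ?_)
      rw [abs_mul]
      calc |ε| * |h t| ≤ 1 * D := mul_le_mul hε.le h2 (abs_nonneg _) zero_le_one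
        _ = D := one_mul D
    have h4 := hB _ (abs_le.1 h3)
    exact mul_le_mul h4 h2 (norm_nonneg _) ((norm_nonneg _).trans h4)
  · have h1 : HasDerivAt (fun ε : ℝ => φ t + ε * h t) (h t) ε := by
      simpa using ((hasDerivAt_id ε).mul_const (h t)).const_add (φ t)
    exact (hasDerivAt_u _).comp ε h1

/-- The first variation of `∫ (φ'/φ)²` at a positive function: differentiation under the integral is
justified by a multiple of `(|φ'| + |h'|)²`, because `φ + ε h` stays away from zero for small `ε`. -/
theorem hasDerivAt_G (A : ℝ) {φ h : ℝ → ℝ} (hφ : MemW12 φ)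
    (hpos : ∀ t ∈ Icc (0 : ℝ) 1, 0 < φ t) (hh : MemW12 h) :
    HasDerivAt (fun ε : ℝ => G A (fun t => φ t + ε * h t))
      (∫ t in (0 : ℝ)..1,
        2 * (deriv φ t / φ t) * ((deriv h t * φ t - deriv φ t * h t) / φ t ^ 2)) 0 := by
  have hcφ := continuousOn_unit hφ.1
  have hch := continuousOn_unit hh.1
  obtain ⟨t₀, ht₀, hmin⟩ := isCompact_Icc.exists_isMinOn (nonempty_Icc.2 zero_le_one) hcφ
  set c := φ t₀ with hcdef
  have hc : 0 < c := hpos t₀ ht₀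
  have hcle : ∀ t ∈ Icc (0 : ℝ) 1, c ≤ φ t := fun t ht => hmin ht
  obtain ⟨C, hC⟩ := isCompact_Icc.exists_bound_of_continuousOn hcφ
  obtain ⟨D, hD⟩ := isCompact_Icc.exists_bound_of_continuousOn hch
  have hC0 : 0 ≤ C := (norm_nonneg _).trans (hC 0 (left_mem_Icc.2 zero_le_one))
  have hD0 : 0 ≤ D := (norm_nonneg _).trans (hD 0 (left_mem_Icc.2 zero_le_one))
  have hδ : 0 < min 1 (c / (2 * (D + 1))) := by positivity
  have hlow : ∀ ε ∈ Metric.ball (0 : ℝ) (min 1 (c / (2 * (D + 1)))), ∀ t ∈ Icc (0 : ℝ) 1,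
      |ε| ≤ 1 ∧ c / 2 ≤ φ t + ε * h t := by
    intro ε hε t ht
    rw [mem_ball_zero_iff, Real.norm_eq_abs, lt_min_iff] at hε
    refine ⟨hε.1.le, ?_⟩
    have h1 : |ε * h t| ≤ c / 2 := by
      rw [abs_mul]
      calc |ε| * |h t| ≤ c / (2 * (D + 1)) * (D + 1) :=
            mul_le_mul hε.2.le ((hD t ht).trans (by linarith)) (abs_nonneg _) (by positivity)
        _ = c / 2 := by field_simp
    have := neg_le_of_abs_le h1
    have := hcle t ht
    linarith
  have hsub : Ioo (0 : ℝ) 1 ⊆ Icc 0 1 := Ioo_subset_Icc_self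
  have hint : (fun ε : ℝ => G A (fun t => φ t + ε * h t)) = fun ε =>
      (∫ t in Ioo (0 : ℝ) 1, ((deriv φ t + ε * deriv h t) / (φ t + ε * h t)) ^ 2) - A := by
    funext ε
    unfold G
    rw [integral_unit]
    congr 1
    refine integral_congr_ae ?_
    filter_upwards [ae_unit_differentiableAt hφ.1, ae_unit_differentiableAt hh.1] with t h1 h2
    have : deriv (fun t => φ t + ε * h t) t = deriv φ t + ε * deriv h t := by
      rw [deriv_fun_add h1 (h2.const_mul ε), deriv_const_mul_field]
    rw [this]
  rw [hint, integral_unit]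
  have mφ : AEMeasurable φ (volume.restrict (Ioo (0 : ℝ) 1)) :=
    (aestronglyMeasurable_unit hcφ).aemeasurable
  have mh : AEMeasurable h (volume.restrict (Ioo (0 : ℝ) 1)) :=
    (aestronglyMeasurable_unit hch).aemeasurable
  have mφ' : AEMeasurable (deriv φ) (volume.restrict (Ioo (0 : ℝ) 1)) :=
    (measurable_deriv φ).aemeasurable
  have mh' : AEMeasurable (deriv h) (volume.restrict (Ioo (0 : ℝ) 1)) :=
    (measurable_deriv h).aemeasurable
  have hbound : Integrable (fun t => 2 * (C + D) / (c / 2) ^ 3 * (|deriv φ t| + |deriv h t|) ^ 2)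
      (volume.restrict (Ioo (0 : ℝ) 1)) :=
    ((hφ.2.abs.add hh.2.abs).integrable_sq).const_mul _
  have key := hasDerivAt_integral_of_dominated_loc_of_deriv_le
    (μ := volume.restrict (Ioo (0 : ℝ) 1)) (x₀ := (0 : ℝ))
    (F := fun ε t => ((deriv φ t + ε * deriv h t) / (φ t + ε * h t)) ^ 2)
    (F' := fun ε t => 2 * ((deriv φ t + ε * deriv h t) / (φ t + ε * h t)) *
      ((deriv h t * φ t - deriv φ t * h t) / (φ t + ε * h t) ^ 2))
    (Metric.ball_mem_nhds 0 hδ)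
    (Eventually.of_forall fun ε => (((mφ'.add (mh'.const_mul ε)).div
      (mφ.add (mh.const_mul ε))).pow_const 2).aestronglyMeasurable)
    (by simpa [FiniteG, IntegrableOn] using finiteG_of_memW12 hφ hpos)
    ?_ ?_ hbound ?_
  · have := key.2.sub_const A
    simpa using this
  · exact ((((mφ'.add (mh'.const_mul 0)).div (mφ.add (mh.const_mul 0))).const_mul 2).mul
      (((mh'.mul mφ).sub (mφ'.mul mh)).div
        ((mφ.add (mh.const_mul 0)).pow_const 2))).aestronglyMeasurable
  · filter_upwards [ae_restrict_mem measurableSet_Ioo] with t ht ε hε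
    obtain ⟨h1, h2⟩ := hlow ε hε t (hsub ht)
    have hφC := hC t (hsub ht)
    have hhD := hD t (hsub ht)
    rw [Real.norm_eq_abs] at hφC hhD
    set S := |deriv φ t| + |deriv h t| with hS
    have hS0 : 0 ≤ S := by positivity
    have hx : 0 < φ t + ε * h t := by linarith
    have n1 : |deriv φ t + ε * deriv h t| ≤ S := by
      refine (abs_add_le _ _).trans (add_le_add le_rfl ?_)
      rw [abs_mul]
      exact mul_le_of_le_one_left (abs_nonneg _) h1
    have n2 : |deriv h t * φ t - deriv φ t * h t| ≤ (C + D) * S := by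
      refine (abs_sub _ _).trans ?_
      rw [abs_mul, abs_mul]
      have q1 : |deriv h t| * |φ t| ≤ S * C :=
        mul_le_mul (by linarith [abs_nonneg (deriv φ t)]) hφC (abs_nonneg _) hS0
      have q2 : |deriv φ t| * |h t| ≤ S * D :=
        mul_le_mul (by linarith [abs_nonneg (deriv h t)]) hhD (abs_nonneg _) hS0
      linarith
    have e : 2 * ((deriv φ t + ε * deriv h t) / (φ t + ε * h t)) *
        ((deriv h t * φ t - deriv φ t * h t) / (φ t + ε * h t) ^ 2)
        = 2 * ((deriv φ t + ε * deriv h t) * (deriv h t * φ t - deriv φ t * h t)) /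
          (φ t + ε * h t) ^ 3 := by
      field_simp
    rw [e, Real.norm_eq_abs, abs_div, abs_mul, abs_mul, abs_of_pos (pow_pos hx 3), abs_two]
    calc 2 * (|deriv φ t + ε * deriv h t| * |deriv h t * φ t - deriv φ t * h t|) /
          (φ t + ε * h t) ^ 3
        ≤ 2 * (S * ((C + D) * S)) / (c / 2) ^ 3 := by
          refine div_le_div₀ (by positivity) ?_ (by positivity)
            (pow_le_pow_left₀ (by positivity) h2 3)
          exact mul_le_mul_of_nonneg_left (mul_le_mul n1 n2 (abs_nonneg _) hS0) zero_le_two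
      _ = _ := by ring
  · filter_upwards [ae_restrict_mem measurableSet_Ioo] with t ht ε hε
    obtain ⟨h1, h2⟩ := hlow ε hε t (hsub ht)
    have hx : φ t + ε * h t ≠ 0 := by linarith
    have d1 : HasDerivAt (fun ε : ℝ => φ t + ε * h t) (h t) ε := by
      simpa using ((hasDerivAt_id ε).mul_const (h t)).const_add (φ t)
    have d2 : HasDerivAt (fun ε : ℝ => deriv φ t + ε * deriv h t) (deriv h t) ε := by
      simpa using ((hasDerivAt_id ε).mul_const (deriv h t)).const_add (deriv φ t)
    refine ((d2.div d1 hx).pow 2).congr_deriv ?_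
    simp only [Nat.cast_ofNat, Nat.add_one_sub_one, pow_one, Pi.div_apply]
    congr 2
    ring

/-- Criticality over all variations `h = ψ k` is the weak Euler–Lagrange equation. -/
theorem isCriticalPoint_iff (A lam : ℝ) {φ : ℝ → ℝ} (hφ : MemW12 φ)
    (hpos : ∀ t ∈ Icc (0 : ℝ) 1, 0 < φ t) :
    IsCriticalPoint A lam φ ↔ WeakEulerLagrange lam φ := by
  have hvar : ∀ h, MemW012 h → HasDerivAt
      (fun ε : ℝ => J (fun t => φ t + ε * h t) + lam * G A (fun t => φ t + ε * h t))
      ((∫ t in (0 : ℝ)..1, du (φ t) * h t) + lam * ∫ t in (0 : ℝ)..1,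
        2 * (deriv φ t / φ t) * ((deriv h t * φ t - deriv φ t * h t) / φ t ^ 2)) 0 :=
    fun h hh => (hasDerivAt_J (continuousOn_unit hφ.1) (continuousOn_unit hh.1.1)).add
      ((hasDerivAt_G A hφ hpos hh.1).const_mul lam)
  -- the substitution `h = φ k`
  have hsubst : ∀ h k : ℝ → ℝ, MemW12 k → (∀ t ∈ Icc (0 : ℝ) 1, h t = φ t * k t) →
      ((∫ t in (0 : ℝ)..1, du (φ t) * h t) + lam * ∫ t in (0 : ℝ)..1,
        2 * (deriv φ t / φ t) * ((deriv h t * φ t - deriv φ t * h t) / φ t ^ 2))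
      = (∫ t in (0 : ℝ)..1, du (φ t) * φ t * k t) +
        2 * lam * ∫ t in (0 : ℝ)..1, deriv φ t / φ t * deriv k t := by
    intro h k hk hhk
    congr 1
    · refine intervalIntegral.integral_congr fun t ht => ?_
      rw [uIcc_of_le zero_le_one] at ht
      simp only [hhk t ht, mul_assoc]
    · rw [mul_comm 2 lam, mul_assoc, ← intervalIntegral.integral_const_mul 2, integral_unit,
        integral_unit]
      congr 1
      refine integral_congr_ae ?_
      filter_upwards [ae_unit_differentiableAt hφ.1, ae_unit_differentiableAt hk.1,
        ae_restrict_mem measurableSet_Ioo] with t h1 h2 ht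
      have e : h =ᶠ[𝓝 t] fun t => φ t * k t := by
        filter_upwards [isOpen_Ioo.mem_nhds ht] with s hs using hhk s (Ioo_subset_Icc_self hs)
      have hp := (hpos t (Ioo_subset_Icc_self ht)).ne'
      rw [e.deriv_eq, deriv_fun_mul h1 h2, hhk t (Ioo_subset_Icc_self ht)]
      field_simp
      ring
  constructor
  · intro hcrit k hk
    have hh : MemW012 fun t => φ t * k t :=
      ⟨hφ.mul hk.1, by simp [hk.2.1], by simp [hk.2.2]⟩
    rw [← hsubst (fun t => φ t * k t) k hk.1 fun _ _ => rfl]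
    exact (hvar _ hh).unique (hcrit _ hh)
  · intro hweak h hh
    have hk : MemW012 fun t => (φ t)⁻¹ * h t :=
      ⟨(hφ.inv hpos).mul hh.1, by simp [hh.2.1], by simp [hh.2.2]⟩
    have := hvar h hh
    rwa [hsubst h _ hk.1 fun t ht => (mul_inv_cancel_left₀ (hpos t ht).ne' _).symm,
      hweak _ hk] at this

/-! ### Solutions of the weak equation minimize -/

theorem du_eq (s : ℝ) : du s = 2 * (s - 1) * (2 * s ^ 2 + 2 * s + 1) := by
  unfold du; ring

theorem du_nonneg {s : ℝ} (hs : 1 ≤ s) : 0 ≤ du s := by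
  rw [du_eq]
  exact mul_nonneg (by linarith) (by positivity)

/-- In the variable `log s` the graph of `u` lies above its tangent lines at the points `a ≥ 1`. It
follows from the tangent inequality in the variable `s` and from `log x ≤ x - 1`. -/
theorem u_tangent_log {a b : ℝ} (ha : 1 ≤ a) (hb : 0 < b) :
    u a + du a * a * (Real.log b - Real.log a) ≤ u b := by
  have ha0 : 0 < a := zero_lt_one.trans_le ha
  have hlog : Real.log b - Real.log a ≤ b / a - 1 := by
    rw [← Real.log_div hb.ne' ha0.ne']
    exact Real.log_le_sub_one_of_pos (div_pos hb ha0)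
  have h1 : du a * a * (Real.log b - Real.log a) ≤ du a * a * (b / a - 1) :=
    mul_le_mul_of_nonneg_left hlog (mul_nonneg (du_nonneg ha) ha0.le)
  have h2 : du a * a * (b / a - 1) = du a * (b - a) := by
    field_simp
  have h3 : u b - u a - du a * (b - a) = (b - a) ^ 2 * (b ^ 2 + 2 * a * b + 3 * a ^ 2 - 1) := by
    unfold u du; ring
  have h4 : 0 ≤ (b - a) ^ 2 * (b ^ 2 + 2 * a * b + 3 * a ^ 2 - 1) :=
    mul_nonneg (sq_nonneg _) (by nlinarith [mul_pos ha0 hb])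
  linarith

theorem G_eq_zero_iff {A : ℝ} {φ : ℝ → ℝ} :
    G A φ = 0 ↔ ∫ t in (0 : ℝ)..1, (deriv φ t / φ t) ^ 2 = A := sub_eq_zero

/-- A solution of the weak equation with values in `[1, ∞)` minimizes `J` under the constraint, with
a quantitative gap. Test the equation with `k = log φ - log ψ`, use the tangent inequality for `u`,
and complete the square in `2 p (q - p) = q² - p² - (q - p)²`. -/
theorem J_add_le {R A lam : ℝ} {ψ φ : ℝ → ℝ} (hlam : 0 < lam) (hψ : ψ ∈ Q12 R)
    (hψG : FiniteG ψ) (hψA : G A ψ = 0) (hψ1 : ∀ t ∈ Icc (0 : ℝ) 1, 1 ≤ ψ t)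
    (hweak : WeakEulerLagrange lam ψ) (hφ : φ ∈ Q12 R ∩ Constraint A) :
    J ψ + lam * ∫ t in (0 : ℝ)..1, (deriv φ t / φ t - deriv ψ t / ψ t) ^ 2 ≤ J φ := by
  obtain ⟨⟨hφW, hφ0, hφ1⟩, hφG, hφA⟩ := hφ
  obtain ⟨hψW, hψ0, hψR⟩ := hψ
  have hφpos := pos_of_finiteG hφW.1 hφ0 hφG
  have hψpos : ∀ t ∈ Icc (0 : ℝ) 1, 0 < ψ t := fun t ht => zero_lt_one.trans_le (hψ1 t ht)
  have cφ := continuousOn_unit hφW.1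
  have cψ := continuousOn_unit hψW.1
  have lφ := logAC hφW.1 hφpos
  have lψ := logAC hψW.1 hψpos
  have hp := memLp_two_logDeriv cψ hψG
  have hq := memLp_two_logDeriv cφ hφG
  have hk := lφ.fun_sub lψ
  have hder : ∀ᵐ t ∂volume.restrict (Ioo (0 : ℝ) 1),
      deriv (fun t => Real.log (φ t) - Real.log (ψ t)) t
        = deriv φ t / φ t - deriv ψ t / ψ t := by
    filter_upwards [ae_deriv_log hφW.1 hφpos, ae_deriv_log hψW.1 hψpos,
      ae_unit_differentiableAt lφ, ae_unit_differentiableAt lψ] with t h1 h2 h3 h4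
    rw [deriv_fun_sub h3 h4, h1, h2]
  have hkW : MemW012 fun t => Real.log (φ t) - Real.log (ψ t) := by
    refine ⟨⟨hk, (hq.sub hp).ae_eq ?_⟩, by simp [hφ0, hψ0], by simp [hφ1, hψR]⟩
    filter_upwards [hder] with t ht using ht.symm
  have hEL := hweak _ hkW
  have hJ : J ψ + ∫ t in (0 : ℝ)..1,
      du (ψ t) * ψ t * (Real.log (φ t) - Real.log (ψ t)) ≤ J φ := by
    rw [J_eq_integral_u cφ, J_eq_integral_u cψ]
    have i1 := intervalIntegrable_of_continuousOn_unit (continuous_u.comp_continuousOn cψ)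
    have i2 := intervalIntegrable_of_continuousOn_unit
      (((continuous_du.comp_continuousOn cψ).mul cψ).mul (continuousOn_unit hk))
    have i3 := intervalIntegrable_of_continuousOn_unit (continuous_u.comp_continuousOn cφ)
    refine (intervalIntegral.integral_add i1 i2).symm.trans_le ?_
    exact intervalIntegral.integral_mono_on zero_le_one (i1.add i2) i3 fun t ht =>
      u_tangent_log (hψ1 t ht) (hφpos t ht)
  have hcross : ∫ t in (0 : ℝ)..1, deriv ψ t / ψ t *
      deriv (fun t => Real.log (φ t) - Real.log (ψ t)) t
      = ((∫ t in (0 : ℝ)..1, (deriv φ t / φ t) ^ 2) - (∫ t in (0 : ℝ)..1, (deriv ψ t / ψ t) ^ 2)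
        - ∫ t in (0 : ℝ)..1, (deriv φ t / φ t - deriv ψ t / ψ t) ^ 2) / 2 := by
    have j1 := intervalIntegrable_unit.2 hq.integrable_sq
    have j2 := intervalIntegrable_unit.2 hp.integrable_sq
    have j3 := intervalIntegrable_unit.2 (hq.sub hp).integrable_sq
    have e := (intervalIntegral.integral_sub (j1.sub j2) j3)
    rw [intervalIntegral.integral_sub j1 j2] at e
    simp only [Pi.sub_apply] at e
    rw [← e, ← intervalIntegral.integral_div, integral_unit, integral_unit]
    refine integral_congr_ae ?_
    filter_upwards [hder] with t ht
    rw [ht]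
    ring
  rw [hcross] at hEL
  have hG1 := G_eq_zero_iff.1 hψA
  have hG2 : ∫ t in (0 : ℝ)..1, (deriv φ t / φ t) ^ 2 ≤ A := sub_nonpos.1 hφA
  rw [hG1] at hEL
  have := mul_nonneg hlam.le (sub_nonneg.2 hG2)
  linarith

theorem sameOnUnit_of_J_le {R A lam : ℝ} {ψ φ : ℝ → ℝ} (hlam : 0 < lam) (hψ : ψ ∈ Q12 R)
    (hψG : FiniteG ψ) (hψA : G A ψ = 0) (hψ1 : ∀ t ∈ Icc (0 : ℝ) 1, 1 ≤ ψ t)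
    (hweak : WeakEulerLagrange lam ψ) (hφ : φ ∈ Q12 R ∩ Constraint A) (hle : J φ ≤ J ψ) :
    SameOnUnit φ ψ := by
  have hgap := J_add_le hlam hψ hψG hψA hψ1 hweak hφ
  obtain ⟨⟨hφW, hφ0, hφ1⟩, hφG, hφA⟩ := hφ
  obtain ⟨hψW, hψ0, hψR⟩ := hψ
  have hφpos := pos_of_finiteG hφW.1 hφ0 hφG
  have hψpos : ∀ t ∈ Icc (0 : ℝ) 1, 0 < ψ t := fun t ht => zero_lt_one.trans_le (hψ1 t ht)
  have lφ := logAC hφW.1 hφpos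
  have lψ := logAC hψW.1 hψpos
  have hsq := ((memLp_two_logDeriv (continuousOn_unit hφW.1) hφG).sub
    (memLp_two_logDeriv (continuousOn_unit hψW.1) hψG)).integrable_sq
  simp only [Pi.sub_apply] at hsq
  have hzero : ∫ t in Ioo (0 : ℝ) 1, (deriv φ t / φ t - deriv ψ t / ψ t) ^ 2 = 0 := by
    rw [integral_unit] at hgap
    refine le_antisymm ?_ (integral_nonneg fun t => sq_nonneg _)
    by_contra! hpos
    have := mul_pos hlam hpos
    linarith
  rw [integral_eq_zero_iff_of_nonneg (fun t => sq_nonneg _) hsq] at hzero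
  have hk := lφ.fun_sub lψ
  intro t ht
  have hac := hk.mono (c := 0) (d := t) (by
    rw [uIcc_of_le ht.1, uIcc_of_le zero_le_one]; exact Icc_subset_Icc_right ht.2)
  have hint := hac.integral_deriv_eq_sub
  have hint0 : ∫ s in (0 : ℝ)..t, deriv (fun t => Real.log (φ t) - Real.log (ψ t)) s = 0 := by
    rw [intervalIntegral.integral_of_le ht.1, integral_Ioc_eq_integral_Ioo]
    refine integral_eq_zero_of_ae ?_
    refine ae_restrict_of_ae_restrict_of_subset (Ioo_subset_Ioo_right ht.2) ?_
    filter_upwards [hzero, ae_deriv_log hφW.1 hφpos, ae_deriv_log hψW.1 hψpos,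
      ae_unit_differentiableAt lφ, ae_unit_differentiableAt lψ] with s h0 h1 h2 h3 h4
    rw [deriv_fun_sub h3 h4, h1, h2]
    exact pow_eq_zero_iff two_ne_zero |>.1 h0
  rw [hint0, hφ0, hψ0] at hint
  have : Real.log (φ t) = Real.log (ψ t) := by linarith
  exact Real.log_injOn_pos (hφpos t ht) (hψpos t ht) this

/-- A nondecreasing `C¹` function that vanishes exactly on `[0, ∞)`. -/
theorem exists_contDiff_negative_part :
    ∃ g : ℝ → ℝ, ContDiff ℝ 1 g ∧ (∀ x, 0 ≤ deriv g x) ∧ (∀ x, 0 ≤ x → g x = 0) ∧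
      ∀ x < 0, g x < 0 := by
  have hc : Continuous fun s : ℝ => -min s 0 := by fun_prop
  have hd : ∀ x, HasDerivAt (fun x => ∫ s in (0 : ℝ)..x, -min s 0) (-min x 0) x := fun x =>
    (hc.integral_hasStrictDerivAt 0 x).hasDerivAt
  refine ⟨fun x => ∫ s in (0 : ℝ)..x, -min s 0, ?_, fun x => ?_, fun x hx => ?_, fun x hx => ?_⟩
  · rw [contDiff_one_iff_deriv]
    refine ⟨fun x => (hd x).differentiableAt, ?_⟩
    rwa [funext fun x => (hd x).deriv]
  · rw [(hd x).deriv]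
    exact neg_nonneg.2 (min_le_right _ _)
  · beta_reduce
    rw [intervalIntegral.integral_congr (g := fun _ => (0 : ℝ))]
    · simp
    · intro s hs
      rw [uIcc_of_le hx] at hs
      simp only [min_eq_right hs.1, neg_zero]
  · beta_reduce
    rw [intervalIntegral.integral_symm, neg_neg_iff_pos]
    refine intervalIntegral.intervalIntegral_pos_of_pos_on (hc.intervalIntegrable _ _)
      (fun s hs => ?_) hx
    rw [min_eq_left hs.2.le]
    exact neg_pos.2 hs.2

/-- Weak solutions stay above `1`: test with a `C¹` truncation of the negative part of `log φ`;
below the level `1` the function `u` is decreasing, so both terms of the equation have a sign. -/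
theorem one_le_of_weakEulerLagrange {R lam : ℝ} (hR : 1 < R) (hlam : 0 < lam) {φ : ℝ → ℝ}
    (hφ : φ ∈ Q12 R) (hG : FiniteG φ) (hweak : WeakEulerLagrange lam φ) :
    ∀ t ∈ Icc (0 : ℝ) 1, 1 ≤ φ t := by
  obtain ⟨hφW, hφ0, hφ1⟩ := hφ
  have hpos := pos_of_finiteG hφW.1 hφ0 hG
  have cφ := continuousOn_unit hφW.1
  have lφ := logAC hφW.1 hpos
  obtain ⟨g, hg, hg', hgnn, hgneg⟩ := exists_contDiff_negative_part
  have hk : AbsolutelyContinuousOnInterval (fun t => g (Real.log (φ t))) 0 1 :=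
    lφ.contDiffOn_comp hg.contDiffOn (mapsTo_univ _ _)
  have hder : ∀ᵐ t ∂volume.restrict (Ioo (0 : ℝ) 1), deriv (fun t => g (Real.log (φ t))) t
      = deriv g (Real.log (φ t)) * (deriv φ t / φ t) := by
    filter_upwards [ae_deriv_log hφW.1 hpos, ae_unit_differentiableAt lφ] with t h1 h2
    have := ((hg.differentiable_one _).hasDerivAt.comp t h2.hasDerivAt).deriv
    rw [h1] at this
    exact this
  have hc : ContinuousOn (fun t => deriv g (Real.log (φ t))) (Icc 0 1) :=
    (hg.continuous_deriv le_rfl).comp_continuousOn (continuousOn_unit lφ)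
  have hkW : MemW012 fun t => g (Real.log (φ t)) := by
    refine ⟨⟨hk, (memLp_two_continuousOn_mul hc (memLp_two_logDeriv cφ hG)).ae_eq ?_⟩, ?_, ?_⟩
    · filter_upwards [hder] with t ht using ht.symm
    · beta_reduce; rw [hφ0, Real.log_one]; exact hgnn 0 le_rfl
    · beta_reduce; rw [hφ1]; exact hgnn _ (Real.log_nonneg hR.le)
  have hEL := hweak _ hkW
  have h2 : 0 ≤ ∫ t in (0 : ℝ)..1, deriv φ t / φ t * deriv (fun t => g (Real.log (φ t))) t := by
    rw [integral_unit]
    refine integral_nonneg_of_ae ?_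
    filter_upwards [hder] with t ht
    rw [ht]
    have := mul_nonneg (hg' (Real.log (φ t))) (mul_self_nonneg (deriv φ t / φ t))
    simp only [Pi.zero_apply]
    linarith
  have hlt : ∀ t ∈ Icc (0 : ℝ) 1, φ t < 1 → 0 < du (φ t) * φ t * g (Real.log (φ t)) := by
    intro t ht h
    have h3 := hpos t ht
    have h4 : du (φ t) < 0 := by
      rw [du_eq]
      exact mul_neg_of_neg_of_pos (by linarith) (by positivity)
    exact mul_pos_of_neg_of_neg (mul_neg_of_neg_of_pos h4 h3) (hgneg _ (Real.log_neg h3 h))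
  intro t ht
  by_contra! h
  have h1 : 0 < ∫ t in (0 : ℝ)..1, du (φ t) * φ t * g (Real.log (φ t)) := by
    refine intervalIntegral.integral_pos one_pos
      (((continuous_du.comp_continuousOn cφ).mul cφ).mul (continuousOn_unit hk)) ?_
      ⟨t, ht, hlt t ht h⟩
    intro s hs
    rcases lt_or_ge (φ s) 1 with h' | h'
    · exact (hlt s (Ioc_subset_Icc_self hs) h').le
    · rw [hgnn _ (Real.log_nonneg h'), mul_zero]
  have := mul_nonneg hlam.le h2
  linarith

/-! ### The distortion energy of radial morphs -/

theorem γ_eq (s : ℝ) :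
    γ s = Real.cos s • EuclideanSpace.single 0 1 + Real.sin s • EuclideanSpace.single 1 1 := by
  ext i; fin_cases i <;> simp [γ]

theorem quarterTurn_γ (s : ℝ) : quarterTurn (γ s)
    = -Real.sin s • EuclideanSpace.single 0 1 + Real.cos s • EuclideanSpace.single 1 1 := by
  ext i; fin_cases i <;> simp [γ, quarterTurn]

theorem hasDerivAt_γ (s : ℝ) : HasDerivAt γ (quarterTurn (γ s)) s := by
  rw [quarterTurn_γ, funext γ_eq]
  exact ((Real.hasDerivAt_cos s).smul_const _).add ((Real.hasDerivAt_sin s).smul_const _)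

theorem hasDerivAt_quarterTurn_γ (s : ℝ) :
    HasDerivAt (fun s => quarterTurn (γ s)) (-γ s) s := by
  rw [γ_eq, funext quarterTurn_γ, neg_add, ← neg_smul, ← neg_smul]
  exact ((Real.hasDerivAt_sin s).neg.smul_const _).add ((Real.hasDerivAt_cos s).smul_const _)

theorem contDiff_γ {n : WithTop ℕ∞} : ContDiff ℝ n γ := by
  rw [funext γ_eq]
  exact (Real.contDiff_cos.smul contDiff_const).add (Real.contDiff_sin.smul contDiff_const)

theorem quarterTurn_quarterTurn (w : Plane) : quarterTurn (quarterTurn w) = -w := by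
  ext i; fin_cases i <;> simp [quarterTurn]

theorem quarterTurn_smul (a : ℝ) (w : Plane) : quarterTurn (a • w) = a • quarterTurn w := by
  ext i; fin_cases i <;> simp [quarterTurn]

theorem norm_quarterTurn (w : Plane) : ‖quarterTurn w‖ = ‖w‖ := by
  simp [EuclideanSpace.norm_eq, quarterTurn, Fin.sum_univ_two, add_comm]

theorem norm_γ (s : ℝ) : ‖γ s‖ = 1 := by
  simp [EuclideanSpace.norm_eq, γ, Fin.sum_univ_two]

theorem γ_mem (s : ℝ) : γ s ∈ unitCircle := mem_sphere_zero_iff_norm.2 (norm_γ s)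

theorem deriv_smul_γ (a : ℝ) : deriv (fun s => a • γ s) = fun s => a • quarterTurn (γ s) :=
  funext fun s => ((hasDerivAt_γ s).const_smul a).deriv

theorem firstForm_smul_γ (a s : ℝ) : firstForm (fun s => a • γ s) s = a ^ 2 := by
  rw [firstForm, deriv_smul_γ, real_inner_self_eq_norm_sq, norm_smul, norm_quarterTurn, norm_γ,
    mul_one, Real.norm_eq_abs, sq_abs]

theorem secondForm_smul_γ {a : ℝ} (ha : 0 < a) (s : ℝ) :
    secondForm (fun s => a • γ s) s = a := by
  have h : deriv (fun s => a • quarterTurn (γ s)) s = a • -γ s :=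
    ((hasDerivAt_quarterTurn_γ s).const_smul a).deriv
  rw [secondForm, deriv_smul_γ, h, quarterTurn_smul, quarterTurn_quarterTurn,
    real_inner_self_eq_norm_sq, norm_smul, norm_smul, norm_neg, norm_quarterTurn, norm_γ,
    Real.norm_eq_abs, abs_of_pos ha]
  field_simp

theorem distortionEnergy_eq {F : Plane → ℝ → Plane} {φ : ℝ → ℝ}
    (hF : SameMorph F (radialMorph φ)) (hpos : ∀ t ∈ Icc (0 : ℝ) 1, 0 < φ t) :
    distortionEnergy F = 2 * Real.pi * J φ := by
  have hcurve : ∀ t ∈ Icc (0 : ℝ) 1, (fun s => F (γ s) t) = fun s => φ t • γ s :=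
    fun t ht => funext fun s => hF _ (γ_mem s) t ht
  have hγ : γ = fun s => (1 : ℝ) • γ s := by simp
  have h1 : ∀ s, firstForm γ s = 1 := fun s => by
    rw [hγ, firstForm_smul_γ, one_pow]
  have h2 : ∀ s, secondForm γ s = 1 := fun s => by
    rw [hγ, secondForm_smul_γ one_pos]
  unfold distortionEnergy J
  rw [mul_add, ← intervalIntegral.integral_const_mul, ← intervalIntegral.integral_const_mul]
  congr 1
  · refine intervalIntegral.integral_congr fun t ht => ?_
    rw [uIcc_of_le zero_le_one] at ht
    simp only [hcurve t ht, firstForm_smul_γ, h1, intervalIntegral.integral_const, sub_zero,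
      smul_eq_mul]
  · refine intervalIntegral.integral_congr fun t ht => ?_
    rw [uIcc_of_le zero_le_one] at ht
    simp only [hcurve t ht, secondForm_smul_γ (hpos t ht), h2, intervalIntegral.integral_const,
      sub_zero, smul_eq_mul]

theorem radialMorph_isMorph {R : ℝ} (hR : 0 < R) {φ : ℝ → ℝ}
    (hφ : AbsolutelyContinuousOnInterval φ 0 1) (h0 : φ 0 = 1) (h1 : φ 1 = R)
    (hpos : ∀ t ∈ Icc (0 : ℝ) 1, 0 < φ t) : IsMorph R (radialMorph φ) where
  continuousOn := ((continuousOn_unit hφ).comp continuousOn_snd fun _ hq => hq.2).smul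
    continuousOn_fst
  initial p _ := by rw [radialMorph, h0, one_smul]
  final := by
    simp only [radialMorph, h1, unitCircle]
    rw [image_smul, smul_sphere _ _ zero_le_one, smul_zero, mul_one, Real.norm_eq_abs, abs_of_pos hR]
  absCont p _ := hφ.fun_smul
    (contDiffOn_const (c := p)).absolutelyContinuousOnInterval
  smooth t _ := contDiff_γ.const_smul (φ t)
  immersion t ht s := by
    simp only [radialMorph]
    rw [deriv_smul_γ, smul_ne_zero_iff, ← norm_ne_zero_iff (a := quarterTurn _), norm_quarterTurn,
      norm_γ]
    exact ⟨(hpos t ht).ne', one_ne_zero⟩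
  injective t ht _ _ _ _ h := smul_right_injective _ (hpos t ht).ne' h

/-! ### The norm of the generating field -/

theorem sobolevNormSq_smul (R : ℝ) (k : ℕ) (c : ℝ) {w : Plane → Plane}
    (hw : ContDiff ℝ (⊤ : ℕ∞) w) :
    sobolevNormSq R k (fun x => c • w x) = ‖c‖ₑ ^ 2 * sobolevNormSq R k w := by
  unfold sobolevNormSq
  rw [Finset.mul_sum]
  refine Finset.sum_congr rfl fun m _ => ?_
  rw [Finset.mul_sum]
  refine Finset.sum_congr rfl fun a _ => ?_
  rw [← lintegral_const_mul' _ _ (by finiteness)]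
  refine lintegral_congr fun x => ?_
  have h : iteratedFDeriv ℝ m (c • w) x = c • iteratedFDeriv ℝ m w x :=
    iteratedFDeriv_const_smul_apply (hw.contDiffAt.of_le (mod_cast le_top))
  change ‖iteratedFDeriv ℝ m (c • w) x _‖ₑ ^ 2 = _
  rw [h, smul_apply, enorm_smul, mul_pow]
  rfl

theorem lintegral_sq_le_iff {A : ℝ} (hA : 0 ≤ A) {φ : ℝ → ℝ} (hφ : ContinuousOn φ (Icc 0 1)) :
    ∫⁻ t in Ioo (0 : ℝ) 1, ‖deriv φ t / φ t‖ₑ ^ 2 ≤ ENNReal.ofReal A ↔ φ ∈ Constraint A := by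
  have he : ∀ t, ‖deriv φ t / φ t‖ₑ ^ 2 = ENNReal.ofReal ((deriv φ t / φ t) ^ 2) := fun t => by
    rw [Real.enorm_eq_ofReal_abs, ← ENNReal.ofReal_pow (abs_nonneg _), sq_abs]
  simp only [he]
  have hmeas : AEStronglyMeasurable (fun t => (deriv φ t / φ t) ^ 2)
      (volume.restrict (Ioo (0 : ℝ) 1)) :=
    (((measurable_deriv φ).aemeasurable.div
      (aestronglyMeasurable_unit hφ).aemeasurable).pow_const 2).aestronglyMeasurable
  have hG : FiniteG φ → (∫⁻ t in Ioo (0 : ℝ) 1, ENNReal.ofReal ((deriv φ t / φ t) ^ 2)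
      ≤ ENNReal.ofReal A ↔ G A φ ≤ 0) := fun h => by
    rw [← ofReal_integral_eq_lintegral_ofReal h (Eventually.of_forall fun t => sq_nonneg _),
      ENNReal.ofReal_le_ofReal_iff hA, G, integral_unit, sub_nonpos]
  constructor
  · intro h
    have hfin : FiniteG φ := by
      refine ⟨hmeas, ?_⟩
      rw [hasFiniteIntegral_iff_ofReal (Eventually.of_forall fun t => sq_nonneg _)]
      exact h.trans_lt ENNReal.ofReal_lt_top
    exact ⟨hfin, (hG hfin).1 h⟩
  · rintro ⟨hfin, h⟩
    exact (hG hfin).2 h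

/-- The bound on the norm of the generating field is the constraint `G ≤ 0`. The hypothesis on `A`
forces the norm of `ρ id` to be finite and nonzero. -/
theorem fieldNormSq_le_iff {R A P : ℝ} {ρ : Plane → ℝ} (hρ : IsBump R ρ) (hA : 0 < A)
    (hAP : A = constantA R ρ P) {φ : ℝ → ℝ} (hφ : ContinuousOn φ (Icc 0 1)) :
    fieldNormSq R 5 (radialField ρ φ) ≤ ENNReal.ofReal (P ^ 2) ↔ φ ∈ Constraint A := by
  set N := sobolevNormSq R 5 (fun x => ρ x • x) with hN
  have hN0 : N.toReal ≠ 0 := by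
    intro h
    rw [constantA, ← hN, h, inv_zero, zero_mul] at hAP
    exact hA.ne' hAP
  have hP : ENNReal.ofReal (P ^ 2) = ENNReal.ofReal A * N := by
    rw [← ENNReal.ofReal_toReal (ENNReal.toReal_ne_zero.1 hN0).2, ← ENNReal.ofReal_mul hA.le, hAP,
      constantA, ← hN]
    congr 1
    field_simp
  have hw : ContDiff ℝ (⊤ : ℕ∞) fun x : Plane => ρ x • x := hρ.1.smul contDiff_id
  have hF : fieldNormSq R 5 (radialField ρ φ)
      = (∫⁻ t in Ioo (0 : ℝ) 1, ‖deriv φ t / φ t‖ₑ ^ 2) * N := by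
    rw [← lintegral_mul_const' _ _ (ENNReal.toReal_ne_zero.1 hN0).2]
    exact lintegral_congr fun t => sobolevNormSq_smul R 5 _ hw
  rw [hF, hP, ENNReal.mul_le_mul_iff_left (ENNReal.toReal_ne_zero.1 hN0).1
    (ENNReal.toReal_ne_zero.1 hN0).2, lintegral_sq_le_iff hA.le hφ]

theorem generates_radialMorph {R : ℝ} {ρ : Plane → ℝ} (hρ : IsBump R ρ) {φ : ℝ → ℝ}
    (hd : ∀ t ∈ Ioo (0 : ℝ) 1, DifferentiableAt ℝ φ t) (hpos : ∀ t ∈ Icc (0 : ℝ) 1, 0 < φ t)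
    (hle : ∀ t ∈ Icc (0 : ℝ) 1, φ t ≤ R) :
    Generates (radialField ρ φ) (radialMorph φ) := by
  intro p hp t ht
  have ht' := Ioo_subset_Icc_self ht
  have hnorm : ‖p‖ = 1 := mem_sphere_zero_iff_norm.1 hp
  -- the morph stays in the disk on which `ρ = 1`
  have hone : ρ (φ t • p) = 1 := hρ.2.2.1 _ (by
    rw [mem_ball_zero_iff, norm_smul, hnorm, mul_one, Real.norm_eq_abs, abs_of_pos (hpos t ht')]
    linarith [hle t ht'])
  have h := (hd t ht).hasDerivAt.smul_const p
  refine h.congr_deriv ?_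
  rw [radialField, radialMorph, hone, one_smul, smul_smul, div_mul_cancel₀ _ (hpos t ht').ne']

end CircleMorph

end

theorem mainTheorem4 (R A : ℝ) (hR : 1 < R) (hA : Real.log R ^ 2 < A) :
    -- the product of the two integrals, as a function of `mu`
    StrictAntiOn (fun mu => CircleMorph.actionIntegral R mu * CircleMorph.timeIntegral R mu)
      (Ioi 0) ∧
    Tendsto (fun mu => CircleMorph.actionIntegral R mu * CircleMorph.timeIntegral R mu)
      (𝓝[>] 0) atTop ∧
    Tendsto (fun mu => CircleMorph.actionIntegral R mu * CircleMorph.timeIntegral R mu)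
      atTop (𝓝 (Real.log R ^ 2)) ∧
    ∃ (lam mu : ℝ) (ψ : ℝ → ℝ),
      -- the unique positive solution of the system
      CircleMorph.SolvesSystem R A lam mu ∧
      (∀ lam' mu' : ℝ, CircleMorph.SolvesSystem R A lam' mu' → lam' = lam ∧ mu' = mu) ∧
      -- conditions (i) and (ii), which determine `ψ` within `C²(0,1) ∩ Q^{1,2}`
      ContDiffOn ℝ 2 ψ (Ioo 0 1) ∧ ψ ∈ CircleMorph.Q12 R ∧
      CircleMorph.IsCriticalPoint A lam ψ ∧
      CircleMorph.FiniteG ψ ∧ CircleMorph.G A ψ = 0 ∧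
      (∀ (lam' : ℝ) (φ : ℝ → ℝ), 0 < lam' → ContDiffOn ℝ 2 φ (Ioo 0 1) →
        φ ∈ CircleMorph.Q12 R → CircleMorph.IsCriticalPoint A lam' φ →
        CircleMorph.FiniteG φ → CircleMorph.G A φ = 0 → CircleMorph.SameOnUnit φ ψ) ∧
      -- (iii) monotonicity and the initial value problem
      StrictMonoOn ψ (Icc 0 1) ∧
      ψ 0 = 1 ∧
      (∀ t ∈ Icc (0 : ℝ) 1, HasDerivWithinAt ψ
        (1 / √lam * ψ t * √(mu + (ψ t ^ 2 - 1) ^ 2 + (ψ t - 1) ^ 2)) (Icc 0 1) t) ∧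
      -- (iv) unique minimizer, over `Q_+` and over `Q^{1,2}`
      CircleMorph.IsUniqueMinimizer CircleMorph.J
        (CircleMorph.Qplus R ∩ CircleMorph.Constraint A) CircleMorph.SameOnUnit ψ ∧
      CircleMorph.IsUniqueMinimizer CircleMorph.J
        (CircleMorph.Q12 R ∩ CircleMorph.Constraint A) CircleMorph.SameOnUnit ψ ∧
      -- the radial morph with radius function `ψ` is the unique minimal distortion morph
      (∀ (ρ : CircleMorph.Plane → ℝ) (P : ℝ), CircleMorph.IsBump R ρ → 0 < P →
        A = CircleMorph.constantA R ρ P →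
        CircleMorph.IsUniqueMinimizer CircleMorph.distortionEnergy
          (CircleMorph.admissibleMorphs R ρ P) CircleMorph.SameMorph
          (CircleMorph.radialMorph ψ)) := by
  have hA0 : 0 < A := (sq_nonneg _).trans_lt hA
  obtain ⟨lam, mu, hsys, huniq⟩ := CircleMorph.exists_solvesSystem hR hA
  obtain ⟨hlam, hmu, hT, hS⟩ := id hsys
  obtain ⟨ψ, hψ⟩ := CircleMorph.exists_isProfile hR hlam hmu hT
  have hψpos : ∀ t ∈ Icc (0 : ℝ) 1, 0 < ψ t := fun _ => hψ.pos
  have hψ1 : ∀ t ∈ Icc (0 : ℝ) 1, 1 ≤ ψ t := fun t ht => (hψ.mem_Icc ht).1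
  have hG : CircleMorph.G A ψ = 0 :=
    CircleMorph.G_eq_zero_iff.2 (hψ.integral_logDeriv_sq.trans hS)
  have hweak := hψ.weakEulerLagrange hlam hmu
  have hcons : ψ ∈ CircleMorph.Constraint A := ⟨hψ.finiteG, hG.le⟩
  have hmin : ∀ φ ∈ CircleMorph.Q12 R ∩ CircleMorph.Constraint A,
      CircleMorph.J ψ ≤ CircleMorph.J φ := fun φ hφ => by
    refine le_trans ?_
      (CircleMorph.J_add_le hlam hψ.mem_Q12 hψ.finiteG hG hψ1 hweak hφ)
    refine le_add_of_nonneg_right (mul_nonneg hlam.le ?_)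
    exact intervalIntegral.integral_nonneg zero_le_one fun t _ => sq_nonneg _
  have hminuniq : ∀ φ ∈ CircleMorph.Q12 R ∩ CircleMorph.Constraint A,
      CircleMorph.J φ ≤ CircleMorph.J ψ → CircleMorph.SameOnUnit φ ψ := fun φ hφ =>
    CircleMorph.sameOnUnit_of_J_le hlam hψ.mem_Q12 hψ.finiteG hG hψ1 hweak hφ
  have hsub : ∀ φ ∈ CircleMorph.Qplus R ∩ CircleMorph.Constraint A,
      φ ∈ CircleMorph.Q12 R ∩ CircleMorph.Constraint A := fun φ hφ =>
    ⟨CircleMorph.Qplus_subset_Q12 hφ.1 hφ.2.1, hφ.2⟩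
  refine ⟨CircleMorph.product_strictAntiOn hR, CircleMorph.product_tendsto_zero hR,
    CircleMorph.product_tendsto_atTop hR, lam, mu, ψ, hsys, huniq, hψ.contDiffOn hmu, hψ.mem_Q12,
    (CircleMorph.isCriticalPoint_iff A lam hψ.memW12 hψpos).2 hweak, hψ.finiteG, hG, ?_,
    hψ.strictMono.strictMonoOn _, hψ.zero, ?_, ⟨⟨hψ.mem_Qplus hmu, hcons⟩, ?_, ?_⟩,
    ⟨⟨hψ.mem_Q12, hcons⟩, hmin, ?_⟩, ?_⟩
  · -- another critical point is again at least `1`, hence a minimizer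
    intro lam' φ hlam' _ hφ hcrit hφG hφ0
    have hφpos := CircleMorph.pos_of_finiteG hφ.1.1 hφ.2.1 hφG
    have hφweak := (CircleMorph.isCriticalPoint_iff A lam' hφ.1 hφpos).1 hcrit
    have hφ1 := CircleMorph.one_le_of_weakEulerLagrange hR hlam' hφ hφG hφweak
    refine hminuniq φ ⟨hφ, hφG, hφ0.le⟩ (le_trans ?_
      (CircleMorph.J_add_le hlam' hφ hφG hφ0 hφ1 hφweak ⟨hψ.mem_Q12, hcons⟩))
    refine le_add_of_nonneg_right (mul_nonneg hlam'.le ?_)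
    exact intervalIntegral.integral_nonneg zero_le_one fun t _ => sq_nonneg _
  · intro t ht
    have := hψ.hasDerivAt t ht
    rw [CircleMorph.u, ← add_assoc] at this
    exact this.hasDerivWithinAt
  · exact fun φ hφ => hmin φ (hsub φ hφ)
  · exact fun φ hφ hφmin => hminuniq φ (hsub φ hφ) (hφmin ψ ⟨hψ.mem_Qplus hmu, hcons⟩)
  · exact fun φ hφ hφmin => hminuniq φ hφ (hφmin ψ ⟨hψ.mem_Q12, hcons⟩)
  · intro ρ P hρ _ hAP
    have hψE := CircleMorph.distortionEnergy_eq (F := CircleMorph.radialMorph ψ)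
      (fun _ _ _ _ => rfl) hψpos
    have hadm : CircleMorph.radialMorph ψ ∈ CircleMorph.admissibleMorphs R ρ P :=
      ⟨CircleMorph.radialMorph_isMorph (zero_lt_one.trans hR) hψ.absCont hψ.zero hψ.one hψpos,
        ψ, hψ.mem_Qplus hmu, fun _ _ _ _ => rfl,
        CircleMorph.generates_radialMorph hρ
          (fun t _ => hψ.contDiff.differentiable_one t) hψpos fun t ht => (hψ.mem_Icc ht).2,
        (CircleMorph.fieldNormSq_le_iff hρ hA0 hAP hψ.contDiff.continuous.continuousOn).2 hcons⟩
    have hrad : ∀ F ∈ CircleMorph.admissibleMorphs R ρ P,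
        ∃ φ ∈ CircleMorph.Q12 R ∩ CircleMorph.Constraint A,
          CircleMorph.SameMorph F (CircleMorph.radialMorph φ) ∧
          CircleMorph.distortionEnergy F = 2 * Real.pi * CircleMorph.J φ := by
      rintro F ⟨-, φ, hφ, hF, -, hnorm⟩
      have hc := (CircleMorph.fieldNormSq_le_iff hρ hA0 hAP hφ.2.1).1 hnorm
      have hQ := hsub φ ⟨hφ, hc⟩
      exact ⟨φ, hQ, hF, CircleMorph.distortionEnergy_eq hF
        (CircleMorph.pos_of_finiteG hQ.1.1.1 hQ.1.2.1 hc.1)⟩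
    refine ⟨hadm, fun F hF => ?_, fun F hF hFmin => ?_⟩
    · obtain ⟨φ, hφ, -, hE⟩ := hrad F hF
      rw [hψE, hE]
      exact mul_le_mul_of_nonneg_left (hmin φ hφ) (by positivity)
    · obtain ⟨φ, hφ, hFφ, hE⟩ := hrad F hF
      have hle := hFmin _ hadm
      rw [hψE, hE] at hle
      have hsame := hminuniq φ hφ (le_of_mul_le_mul_left hle (by positivity))
      intro p hp t ht
      rw [hFφ p hp t ht, CircleMorph.radialMorph, CircleMorph.radialMorph, hsame ht]
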